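/- Let $K$ be an algebraically closed field of characteristic $0$ (for instance $K=\mathbb{C}$), let $R=K[x,y,z]$ with the standard grading, let $n\ge 3$ be an integer, and let $$I_n=\bigl(x(y^n-z^n),\;y(z^n-x^n),\;z(x^n-y^n)\bigr)\subset R.$$ For an integer $m\ge 1$ let $$I_n^{(m)}=\bigcap_{\mathfrak p\in \operatorname{Ass}(R/I_n)}\bigl(I_n^mR_{\mathfrak p}\cap R\bigr)$$ be the $m$-th symbolic power of $I_n$. For a nonzero homogeneous ideal $J\subseteq R$ let $\omega(J)$ denote the maximal degree of an element of a minimal set of homogeneous generators of $J$ (this number is the same for all such sets). Then $$\omega\bigl(I_n^{(m)}\bigr)\ge m(n+1)\quad\text{for all } m\ge 1,$$ and $$\omega\bigl(I_n^{(m)}\bigr)= m(n+1)\quad\text{for all } m\ge n^2-3n+2.$$ -/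

import Mathlib

namespace FermatConfiguration

/-- The contraction `I ^ m R_𝔭 ∩ R` of the `m`-th power of `I`, extended to the localization
at the prime `𝔭`. -/
def localizedPower {R : Type*} [CommRing R] (I : Ideal R) (m : ℕ) (p : Ideal R) [p.IsPrime] :
    Ideal R :=
  ((I ^ m).map (algebraMap R (Localization.AtPrime p))).comap
    (algebraMap R (Localization.AtPrime p))

/-- The `m`-th symbolic power `I^(m) = ⋂_{𝔭 ∈ Ass(R/I)} (I ^ m R_𝔭 ∩ R)`. -/
def symbolicPower {R : Type*} [CommRing R] (I : Ideal R) (m : ℕ) : Ideal R :=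
  ⨅ p : associatedPrimes R (R ⧸ I), localizedPower I m p.1

open MvPolynomial in
/-- The Fermat ideal `(x(yⁿ - zⁿ), y(zⁿ - xⁿ), z(xⁿ - yⁿ))` of `K[x, y, z]`. -/
noncomputable def fermatIdeal (K : Type*) [Field K] (n : ℕ) : Ideal (MvPolynomial (Fin 3) K) :=
  Ideal.span
    {X 0 * (X 1 ^ n - X 2 ^ n), X 1 * (X 2 ^ n - X 0 ^ n), X 2 * (X 0 ^ n - X 1 ^ n)}

/-- `S` is a minimal set of homogeneous generators of the ideal `J` (for the standard grading):
it consists of homogeneous polynomials, it generates `J`, and no element of it can be omitted. -/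
structure IsMinimalGeneratingSet {σ K : Type*} [Field K]
    (J : Ideal (MvPolynomial σ K)) (S : Set (MvPolynomial σ K)) : Prop where
  homogeneous : ∀ g ∈ S, ∃ d : ℕ, g.IsHomogeneous d
  span_eq : Ideal.span S = J
  irredundant : ∀ g ∈ S, Ideal.span (S \ {g}) ≠ J

/-- `ω(J) = d`: the homogeneous ideal `J` has a minimal set of homogeneous generators, and in
every such set the maximum of the degrees of the generators exists and equals `d`. -/
def IsMaxGeneratorDegree {σ K : Type*} [Field K] (J : Ideal (MvPolynomial σ K)) (d : ℕ) : Prop :=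
  (∃ S, IsMinimalGeneratingSet J S) ∧
    ∀ S, IsMinimalGeneratingSet J S → IsGreatest (MvPolynomial.totalDegree '' S) d

/-- The value `ω(J)` is unique. -/
theorem IsMaxGeneratorDegree.unique {σ K : Type*} [Field K] {J : Ideal (MvPolynomial σ K)}
    {d e : ℕ} (hd : IsMaxGeneratorDegree J d) (he : IsMaxGeneratorDegree J e) : d = e := by
  obtain ⟨S, hS⟩ := hd.1
  exact (hd.2 S hS).unique (he.2 S hS)

end FermatConfiguration

/-! Write `f = yⁿ - zⁿ`, `g = zⁿ - xⁿ`, `h = xⁿ - yⁿ`, so `f + g + h = 0`. The symbolic power is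
`(f,g)^m ∩ (y,z)^m ∩ (x,z)^m ∩ (x,y)^m` (`symbolicPower_fermatIdeal`), and its maximal generator
degree turns out to be exactly `m(n+1)` for every `m ≥ 1`, which gives both claims.

Upper bound: over `K[xⁿ,yⁿ,zⁿ]` the polynomial ring is free on the monomials with exponents below
`n`. In these coordinates, membership in the intersection becomes a fat point condition at `(1:1:1)`
and the three coordinate points. Forms with prescribed multiplicities at these four points are
spanned by products of the six lines joining them (`IsFatPointForm.mem_span`). Substituting `n`-th
powers back, the ideal is generated by the products `xⁱyʲzᵏfᵖg^qh^r` satisfying linear inequalities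
(`mem_span_fermatProduct`). Degree-lowering rewrites reduce these to products with `p+q+r = m` and
`i+j+k ≤ m`, of degree at most `m(n+1)` (`fermatProduct_mem_span_fermatGenerators`).

Lower bound: on the line `y = z` every element of the ideal becomes divisible by `z^m(zⁿ-xⁿ)^m`, so
those of degree below `m(n+1)` vanish there (`aeval_eq_zero_of_lt_degree`); but `z^m h^m` lies in
the ideal and does not vanish there. -/

namespace FermatConfiguration

/-! ### Powers of an ideal generated by a regular pair. -/

section RegularPairs

variable {R : Type*} [CommRing R]

theorem span_pair_pow (u v : R) (m : ℕ) :
    Ideal.span {u, v} ^ m = Ideal.span {w | ∃ i j, i + j = m ∧ w = u ^ i * v ^ j} := by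
  induction m with
  | zero =>
    have : {w | ∃ i j, i + j = 0 ∧ w = u ^ i * v ^ j} = {(1 : R)} := by
      ext w
      simp
    rw [this, pow_zero, Ideal.span_singleton_one, Ideal.one_eq_top]
  | succ m ih =>
    rw [pow_succ, ih, Ideal.span_mul_span']
    apply le_antisymm
    · rw [Ideal.span_le]
      rintro _ ⟨_, ⟨i, j, hij, rfl⟩, b, hb, rfl⟩
      rcases hb with rfl | rfl
      · exact Ideal.subset_span ⟨i + 1, j, by omega, by simp only; ring⟩
      · exact Ideal.subset_span ⟨i, j + 1, by omega, by simp only; ring⟩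
    · rw [Ideal.span_le]
      rintro _ ⟨i, j, hij, rfl⟩
      apply Ideal.subset_span
      rcases i with _ | i
      · exact ⟨u ^ 0 * v ^ m, ⟨0, m, by omega, rfl⟩, v, by simp, by
          simp only; rw [show j = m + 1 by omega]; ring⟩
      · exact ⟨u ^ i * v ^ j, ⟨i, j, by omega, rfl⟩, u, by simp, by simp only; ring⟩

theorem exists_eq_add_of_mem_span_pair_pow_succ {u v x : R} {m : ℕ}
    (hx : x ∈ Ideal.span {u, v} ^ (m + 1)) :
    ∃ w ∈ Ideal.span {u, v} ^ m, ∃ c, x = u * w + v ^ (m + 1) * c := by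
  have hle : Ideal.span {u, v} ^ (m + 1) ≤
      Ideal.span {u} * Ideal.span {u, v} ^ m ⊔ Ideal.span {v ^ (m + 1)} := by
    rw [span_pair_pow u v (m + 1), Ideal.span_le]
    rintro _ ⟨i, j, hij, rfl⟩
    rcases i with _ | i
    · obtain rfl : j = m + 1 := by omega
      refine Ideal.mem_sup_right ?_
      rw [pow_zero, one_mul]
      exact Ideal.mem_span_singleton_self _
    · refine Ideal.mem_sup_left ?_
      rw [pow_succ', mul_assoc]
      refine Ideal.mul_mem_mul (Ideal.mem_span_singleton_self _) ?_
      rw [span_pair_pow]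
      exact Ideal.subset_span ⟨i, j, by omega, rfl⟩
  obtain ⟨a, ha, b, hb, rfl⟩ := Submodule.mem_sup.1 (hle hx)
  obtain ⟨w, hw, rfl⟩ := Ideal.mem_span_singleton_mul.1 ha
  obtain ⟨c, rfl⟩ := Ideal.mem_span_singleton.1 hb
  exact ⟨w, hw, c, rfl⟩

theorem dvd_of_dvd_pow_mul {u v : R} (h : ∀ a, u ∣ v * a → u ∣ a) (k : ℕ) {a : R}
    (ha : u ∣ v ^ k * a) : u ∣ a := by
  induction k with
  | zero => simpa using ha
  | succ k ih => exact ih (h _ (by rwa [pow_succ', mul_assoc] at ha))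

/-- Splitting off the pure `v`-power leaves `u(w - w') = v^(m+1) c`; regularity forces `u ∣ c`, and
`u` cancels. -/
theorem mem_pow_of_mul_mem_pow_succ [IsDomain R] {u v w : R} (hu : u ≠ 0)
    (h : ∀ a, u ∣ v * a → u ∣ a) {m : ℕ}
    (hw : u * w ∈ Ideal.span {u, v} ^ (m + 1)) : w ∈ Ideal.span {u, v} ^ m := by
  obtain ⟨w', hw', c, hc⟩ := exists_eq_add_of_mem_span_pair_pow_succ hw
  have hdvd : u ∣ v ^ (m + 1) * c := ⟨w - w', by rw [mul_sub, hc]; ring⟩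
  obtain ⟨d, rfl⟩ := dvd_of_dvd_pow_mul h _ hdvd
  have : w = w' + v ^ m * (v * d) := by
    apply mul_left_cancel₀ hu
    rw [hc]; ring
  rw [this]
  refine add_mem hw' (Ideal.mul_mem_right _ _ (Ideal.pow_mem_pow ?_ m))
  exact Ideal.subset_span (by simp)

theorem mem_pow_pred_of_mul_mem_pow [IsDomain R] {u v w : R} (hu : u ≠ 0)
    (h : ∀ a, u ∣ v * a → u ∣ a) {m : ℕ}
    (hw : u * w ∈ Ideal.span {u, v} ^ m) : w ∈ Ideal.span {u, v} ^ (m - 1) := by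
  rcases m with _ | m
  · simp
  · exact mem_pow_of_mul_mem_pow_succ hu h hw

/-- A nonzerodivisor modulo a regular pair is a nonzerodivisor modulo its powers. -/
theorem mem_pow_of_nonzerodivisor_mul_mem [IsDomain R] {u v s : R} (hu : u ≠ 0)
    (h : ∀ a, u ∣ v * a → u ∣ a)
    (hs : ∀ t, s * t ∈ Ideal.span {u, v} → t ∈ Ideal.span {u, v}) (m : ℕ) {t : R}
    (ht : s * t ∈ Ideal.span {u, v} ^ m) : t ∈ Ideal.span {u, v} ^ m := by
  induction m generalizing t with
  | zero => simp
  | succ m ih =>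
    have hvm : v ∈ Ideal.span {u, v} := Ideal.subset_span (by simp)
    have hum : u ∈ Ideal.span {u, v} := Ideal.subset_span (by simp)
    have h1 : t ∈ Ideal.span {u, v} ^ m := ih (Ideal.pow_le_pow_right (Nat.le_succ m) ht)
    rcases m with _ | m
    · rw [zero_add, pow_one] at ht ⊢
      exact hs t ht
    obtain ⟨w, hw, c, rfl⟩ := exists_eq_add_of_mem_span_pair_pow_succ h1
    obtain ⟨w', hw', c', hc'⟩ := exists_eq_add_of_mem_span_pair_pow_succ ht
    -- Comparing `s * t` in both expansions gives `u ∣ v^(m+1) (s c - v c')`, hence `s c ∈ (u, v)`.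
    -- The term `v^(m+1) c` can then be discarded and the induction applied to `w`.
    have hc : c ∈ Ideal.span {u, v} := by
      apply hs
      have hd : u ∣ v ^ (m + 1) * (s * c - v * c') :=
        ⟨w' - s * w, by linear_combination hc'⟩
      obtain ⟨d, hd⟩ := dvd_of_dvd_pow_mul h _ hd
      rw [sub_eq_iff_eq_add.1 hd]
      exact add_mem (Ideal.mul_mem_right _ _ hum) (Ideal.mul_mem_right _ _ hvm)
    have hvc : v ^ (m + 1) * c ∈ Ideal.span {u, v} ^ (m + 1 + 1) := by
      rw [pow_succ _ (m + 1)]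
      exact Ideal.mul_mem_mul (Ideal.pow_mem_pow hvm _) hc
    refine add_mem ?_ hvc
    rw [pow_succ' _ (m + 1)]
    refine Ideal.mul_mem_mul hum (ih ?_)
    refine mem_pow_of_mul_mem_pow_succ hu h ?_
    have := sub_mem ht (Ideal.mul_mem_left _ s hvc)
    convert this using 1
    ring

end RegularPairs

/-! ### Symbolic powers through nonzerodivisors modulo the ideal. -/

section SymbolicPowers

variable {R : Type*} [CommRing R]

theorem mem_localizedPower_iff {I : Ideal R} {m : ℕ} {p : Ideal R} [p.IsPrime] {h : R} :
    h ∈ localizedPower I m p ↔ ∃ s ∉ p, s * h ∈ I ^ m := by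
  rw [localizedPower, Ideal.mem_comap,
    IsLocalization.algebraMap_mem_map_algebraMap_iff p.primeCompl]
  rfl

/-- The zero divisors modulo `I` form the union of the associated primes, so `s` is a legitimate
denominator at each of them. -/
theorem mem_symbolicPower_of_nonzerodivisor {I : Ideal R} {m : ℕ} {s h : R} [IsNoetherianRing R]
    (hs : ∀ t, s * t ∈ I → t ∈ I) (hsh : s * h ∈ I ^ m) : h ∈ symbolicPower I m := by
  rw [symbolicPower, Ideal.mem_iInf]
  rintro ⟨p, hp⟩
  have := hp.isPrime
  refine (mem_localizedPower_iff (p := p)).2 ⟨s, fun hsp => ?_, hsh⟩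
  have : s ∈ ⋃ p ∈ associatedPrimes R (R ⧸ I), (p : Set R) := Set.mem_biUnion hp hsp
  rw [biUnion_associatedPrimes_eq_zero_divisors] at this
  obtain ⟨x, hx, hsx⟩ := this
  obtain ⟨t, rfl⟩ := Ideal.Quotient.mk_surjective x
  rw [Algebra.smul_def, Ideal.Quotient.algebraMap_eq, ← map_mul, Ideal.Quotient.eq_zero_iff_mem]
    at hsx
  exact hx (Ideal.Quotient.eq_zero_iff_mem.2 (hs t hsx))

/-- Prime avoidance: if the colon ideal `(I^m : h)` consisted of zero divisors modulo `I`, it would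
lie in a single associated prime, against the denominator available there. -/
theorem exists_nonzerodivisor_of_mem_symbolicPower {I : Ideal R} {m : ℕ} {h : R}
    [IsNoetherianRing R] (hh : h ∈ symbolicPower I m) :
    ∃ s, (∀ t, s * t ∈ I → t ∈ I) ∧ s * h ∈ I ^ m := by
  rw [symbolicPower, Ideal.mem_iInf] at hh
  by_contra! hcon
  let C : Ideal R := Submodule.comap (LinearMap.mulRight R h) (I ^ m)
  have hC : ∀ s, s ∈ C ↔ s * h ∈ I ^ m := fun s => Iff.rfl
  have hsub : (C : Set R) ⊆ ⋃ p ∈ associatedPrimes R (R ⧸ I), (id p : Ideal R) := by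
    intro s hs
    simp only [id]
    rw [biUnion_associatedPrimes_eq_zero_divisors]
    have : ∃ t, s * t ∈ I ∧ t ∉ I := by
      by_contra! h'
      exact hcon s h' hs
    obtain ⟨t, ht, ht'⟩ := this
    refine ⟨Ideal.Quotient.mk I t, fun h0 => ht' (Ideal.Quotient.eq_zero_iff_mem.1 h0), ?_⟩
    rw [Algebra.smul_def, Ideal.Quotient.algebraMap_eq, ← map_mul, Ideal.Quotient.eq_zero_iff_mem]
    exact ht
  obtain ⟨p, hp, hCp⟩ := (Ideal.subset_union_prime_finite
    (associatedPrimes.finite R (R ⧸ I)) ⊥ ⊥ fun p hp _ _ => hp.isPrime).1 hsub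
  have := hp.isPrime
  obtain ⟨s, hs, hsh⟩ := (mem_localizedPower_iff (p := p)).1 (hh ⟨p, hp⟩)
  exact hs (hCp ((hC s).2 hsh))

end SymbolicPowers

/-! ### Degrees of minimal homogeneous generators. -/

section GeneratorDegrees

open MvPolynomial

variable {σ K : Type*} [Field K]

theorem exists_isMinimalGeneratingSet {J : Ideal (MvPolynomial σ K)}
    (T : Set (MvPolynomial σ K)) (hfin : T.Finite)
    (hhom : ∀ g ∈ T, ∃ d : ℕ, g.IsHomogeneous d) (hspan : Ideal.span T = J) :
    ∃ S, IsMinimalGeneratingSet J S := by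
  induction hn : T.ncard using Nat.strong_induction_on generalizing T with
  | _ c ih =>
    by_cases hirr : ∀ g ∈ T, Ideal.span (T \ {g}) ≠ J
    · exact ⟨T, hhom, hspan, hirr⟩
    · push Not at hirr
      obtain ⟨g, hg, hgJ⟩ := hirr
      refine ih (T \ {g}).ncard ?_ (T \ {g}) hfin.sdiff (fun k hk => hhom k hk.1) hgJ rfl
      rw [← hn]
      exact Set.ncard_sdiff_singleton_lt_of_mem hg hfin

theorem homogeneousComponent_mul_of_isHomogeneous {c : MvPolynomial σ K} {d : ℕ}
    (hc : c.IsHomogeneous d) (w : MvPolynomial σ K) (k : ℕ) :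
    homogeneousComponent k (c * w) = if d ≤ k then c * homogeneousComponent (k - d) w else 0 := by
  have hterm : ∀ i, homogeneousComponent k (c * homogeneousComponent i w) =
      if d + i = k then c * homogeneousComponent i w else 0 := fun i =>
    homogeneousComponent_of_mem (hc.mul (homogeneousComponent_isHomogeneous i w)) |>.trans
      (by simp only [eq_comm])
  conv_lhs => rw [← sum_homogeneousComponent w]
  rw [Finset.mul_sum, map_sum]
  simp only [hterm]
  split_ifs with hdk
  · rw [Finset.sum_eq_single (k - d)]
    · rw [if_pos (by omega)]
    · intro i _ hi
      rw [if_neg (by omega)]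
    · intro hk
      rw [if_pos (by omega), homogeneousComponent_eq_zero _ _ (by rw [Finset.mem_range] at hk; omega),
        mul_zero]
  · exact Finset.sum_eq_zero fun i _ => if_neg (by omega)

/-- A quotient of homogeneous polynomials is homogeneous. -/
theorem degree_add_eq_of_isHomogeneous_mul {c w : MvPolynomial σ K} {d t : ℕ} (hc0 : c ≠ 0)
    (hc : c.IsHomogeneous d) (hcw : (c * w).IsHomogeneous t) {e : σ →₀ ℕ} (he : e ∈ w.support) :
    e.degree + d = t := by
  by_contra hne
  have h1 : c * homogeneousComponent e.degree w = 0 := by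
    have h2 := homogeneousComponent_mul_of_isHomogeneous hc w (e.degree + d)
    rw [if_pos (by omega), Nat.add_sub_cancel, homogeneousComponent_of_mem hcw, if_neg hne] at h2
    exact h2.symm
  have h3 := (mul_eq_zero.1 h1).resolve_left hc0
  have h4 := coeff_homogeneousComponent e.degree w e
  rw [h3, if_pos rfl, coeff_zero] at h4
  exact (mem_support_iff.1 he) h4.symm

theorem homogeneousComponent_mem_span {T : Set (MvPolynomial σ K)}
    (hT : ∀ s ∈ T, ∃ c : ℕ, s.IsHomogeneous c) {a : MvPolynomial σ K} (ha : a ∈ Ideal.span T)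
    (d : ℕ) :
    homogeneousComponent d a ∈ Ideal.span {s ∈ T | ∃ c ≤ d, s.IsHomogeneous c} := by
  suffices h : ∀ r, homogeneousComponent d (a * r) ∈
      Ideal.span {s ∈ T | ∃ c ≤ d, s.IsHomogeneous c} by simpa using h 1
  refine Submodule.span_induction ?_ ?_ ?_ ?_ ha
  · intro s hs r
    obtain ⟨c, hc⟩ := hT s hs
    rw [homogeneousComponent_mul_of_isHomogeneous hc]
    split_ifs with hcd
    · exact Ideal.mul_mem_right _ _ (Ideal.subset_span ⟨hs, c, hcd, hc⟩)
    · exact zero_mem _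
  · intro r
    simp
  · intro x y _ _ hx hy r
    rw [add_mul, map_add]
    exact add_mem (hx r) (hy r)
  · intro b x _ hx r
    have : b • x * r = x * (b * r) := by rw [smul_eq_mul]; ring
    rw [this]
    exact hx _

/-- By homogeneity, elements of `T` need only those members of `S` of degree at most `D`, so a `g ∈
S` of larger degree would be redundant. -/
theorem IsMinimalGeneratingSet.totalDegree_le {J : Ideal (MvPolynomial σ K)}
    {S T : Set (MvPolynomial σ K)} {D : ℕ} (hS : IsMinimalGeneratingSet J S)
    (hT : ∀ h ∈ T, ∃ c ≤ D, h.IsHomogeneous c) (hspan : Ideal.span T = J)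
    {g : MvPolynomial σ K} (hg : g ∈ S) : g.totalDegree ≤ D := by
  by_contra! hlt
  have hg0 : g ≠ 0 := by
    rintro rfl
    simp at hlt
  refine hS.irredundant g hg (le_antisymm ?_ ?_)
  · conv_rhs => rw [← hS.span_eq]
    exact Ideal.span_mono Set.sdiff_subset
  · conv_lhs => rw [← hspan]
    rw [Ideal.span_le]
    intro h hh
    obtain ⟨c, hcD, hc⟩ := hT h hh
    have hmem : h ∈ Ideal.span S := by
      rw [hS.span_eq, ← hspan]
      exact Ideal.subset_span hh
    have := homogeneousComponent_mem_span hS.homogeneous hmem c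
    rw [homogeneousComponent_eq_self hc] at this
    refine Ideal.span_mono ?_ this
    rintro s ⟨hs, b, hbc, hb⟩
    refine ⟨hs, fun hsg => ?_⟩
    rw [Set.mem_singleton_iff.1 hsg] at hb
    have := hb.totalDegree hg0
    omega

/-- The ideal `L` certifies sharpness: without a generator of degree `D`, all of `J` would lie in
`L`. -/
theorem isMaxGeneratorDegree_of_generators {J : Ideal (MvPolynomial σ K)}
    {T : Set (MvPolynomial σ K)} {D : ℕ} (hfin : T.Finite)
    (hT : ∀ h ∈ T, ∃ c ≤ D, h.IsHomogeneous c) (hspan : Ideal.span T = J)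
    (hlow : ∃ L : Ideal (MvPolynomial σ K), ¬ J ≤ L ∧
      ∀ h ∈ J, ∀ c < D, h.IsHomogeneous c → h ∈ L) :
    IsMaxGeneratorDegree J D := by
  refine ⟨exists_isMinimalGeneratingSet T hfin
    (fun h hh => (hT h hh).imp fun c hc => hc.2) hspan, fun S hS => ⟨?_, ?_⟩⟩
  · obtain ⟨L, hJL, hL⟩ := hlow
    by_contra hcon
    refine hJL ?_
    conv_lhs => rw [← hS.span_eq]
    rw [Ideal.span_le]
    intro s hs
    obtain ⟨c, hc⟩ := hS.homogeneous s hs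
    by_cases hs0 : s = 0
    · rw [hs0]
      exact L.zero_mem
    have hsJ : s ∈ J := by
      rw [← hS.span_eq]
      exact Ideal.subset_span hs
    have hle := hS.totalDegree_le hT hspan hs
    have hne : s.totalDegree ≠ D := fun h => hcon ⟨s, hs, h⟩
    have hcd := hc.totalDegree hs0
    exact hL s hsJ c (by omega) hc
  · rintro _ ⟨s, hs, rfl⟩
    exact hS.totalDegree_le hT hspan hs

end GeneratorDegrees
open MvPolynomial

/-! ### Ideals of points and lines as kernels of substitutions. -/

section Substitutions

variable {σ K : Type*} [Field K]

theorem sub_aeval_mem (I : Ideal (MvPolynomial σ K)) (g : σ → MvPolynomial σ K)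
    (h : ∀ i, X i - g i ∈ I) (a : MvPolynomial σ K) : a - aeval g a ∈ I := by
  have : Ideal.Quotient.mkₐ K I = (Ideal.Quotient.mkₐ K I).comp (aeval g) := by
    apply algHom_ext
    intro i
    simpa using Ideal.Quotient.eq.2 (h i)
  exact Ideal.Quotient.eq.1 (DFunLike.congr_fun this a)

/-- The hypotheses make `I` the kernel of a substitution into a domain, hence prime with `s` outside
it. -/
theorem mem_of_mul_mem_of_aeval (I : Ideal (MvPolynomial σ K)) (g : σ → MvPolynomial σ K)
    (h : ∀ i, X i - g i ∈ I) (hI : ∀ a ∈ I, aeval g a = 0) {s t : MvPolynomial σ K}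
    (hs : aeval g s ≠ 0) (hst : s * t ∈ I) : t ∈ I := by
  have h1 := hI _ hst
  rw [map_mul] at h1
  have h2 := sub_aeval_mem I g h t
  rwa [(mul_eq_zero.1 h1).resolve_left hs, sub_zero] at h2

theorem dvd_sub_aeval {l : MvPolynomial σ K} (g : σ → MvPolynomial σ K)
    (h : ∀ i, l ∣ X i - g i) (a : MvPolynomial σ K) : l ∣ a - aeval g a :=
  Ideal.mem_span_singleton.1 (sub_aeval_mem _ g (fun i => Ideal.mem_span_singleton.2 (h i)) a)

theorem dvd_of_dvd_mul_of_aeval {l : MvPolynomial σ K} (g : σ → MvPolynomial σ K)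
    (h : ∀ i, l ∣ X i - g i) (hl : aeval g l = 0) {s t : MvPolynomial σ K}
    (hs : aeval g s ≠ 0) (hst : l ∣ s * t) : l ∣ t := by
  rw [← Ideal.mem_span_singleton] at hst ⊢
  refine mem_of_mul_mem_of_aeval _ g (fun i => Ideal.mem_span_singleton.2 (h i)) ?_ hs hst
  intro a ha
  obtain ⟨b, rfl⟩ := Ideal.mem_span_singleton.1 ha
  rw [map_mul, hl, zero_mul]

theorem mem_span_pair_of_mul_mem {u v : MvPolynomial σ K} (g : σ → MvPolynomial σ K)
    (h : ∀ i, X i - g i ∈ Ideal.span {u, v}) (hu : aeval g u = 0) (hv : aeval g v = 0)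
    {s t : MvPolynomial σ K} (hs : aeval g s ≠ 0) (hst : s * t ∈ Ideal.span {u, v}) :
    t ∈ Ideal.span {u, v} := by
  refine mem_of_mul_mem_of_aeval _ g h ?_ hs hst
  intro a ha
  obtain ⟨b, c, rfl⟩ := Ideal.mem_span_pair.1 ha
  rw [map_add, map_mul, map_mul, hu, hv, mul_zero, mul_zero, add_zero]

theorem pow_dvd_aeval_of_mem_span_pair_pow {l p u : MvPolynomial σ K} {a : ℕ}
    (g : σ → MvPolynomial σ K) (hl : aeval g l = 0) (hp : aeval g p = p)
    (hu : u ∈ Ideal.span {l, p} ^ a) : p ^ a ∣ aeval g u := by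
  have h1 := Ideal.mem_map_of_mem (aeval g : MvPolynomial σ K →ₐ[K] MvPolynomial σ K) hu
  rwa [Ideal.map_pow, Ideal.map_span, Set.image_pair, hl, hp, Ideal.span_insert_zero,
    Ideal.span_singleton_pow, Ideal.mem_span_singleton] at h1

/-- Restriction to `l = 0` of a polynomial with given multiplicities along `p` and `q`. -/
theorem exists_aeval_eq_pow_mul_pow_mul {l p q u : MvPolynomial σ K} {a b : ℕ}
    (g : σ → MvPolynomial σ K) (hl : aeval g l = 0) (hp : aeval g p = p) (hq : aeval g q = q)
    (hprime : Prime p) (hpq : ¬ p ∣ q) (ha : u ∈ Ideal.span {l, p} ^ a)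
    (hb : u ∈ Ideal.span {l, q} ^ b) : ∃ w, aeval g u = p ^ a * q ^ b * w := by
  have h1 := pow_dvd_aeval_of_mem_span_pair_pow g hl hp ha
  obtain ⟨c, hc⟩ := pow_dvd_aeval_of_mem_span_pair_pow g hl hq hb
  rw [hc] at h1
  obtain ⟨w, rfl⟩ := hprime.pow_dvd_of_dvd_mul_left a (fun h => hpq (hprime.dvd_of_dvd_pow h)) h1
  exact ⟨w, by rw [hc]; ring⟩

end Substitutions

/-! ### Fat point forms at four general points are spanned by products of lines. -/

section LineProducts

variable (K : Type*) [Field K]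

/-- Products of the six lines through pairs of the four points `(1:0:0)`, `(0:1:0)`, `(0:0:1)`,
`(1:1:1)`. -/
noncomputable def lineProduct (i j k p q r : ℕ) : MvPolynomial (Fin 3) K :=
  X 0 ^ i * X 1 ^ j * X 2 ^ k * (X 1 - X 2) ^ p * (X 2 - X 0) ^ q * (X 0 - X 1) ^ r

/-- The products of lines of degree `t` with prescribed multiplicities at the four points. -/
def lineProducts (t m a b c : ℕ) : Set (MvPolynomial (Fin 3) K) :=
  {u | ∃ i j k p q r, i + j + k + p + q + r = t ∧ m ≤ p + q + r ∧ a ≤ j + k + p ∧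
    b ≤ i + k + q ∧ c ≤ i + j + r ∧ u = lineProduct K i j k p q r}

/-- The forms of degree `t` with prescribed multiplicities at the four points. -/
structure IsFatPointForm (t m a b c : ℕ) (u : MvPolynomial (Fin 3) K) : Prop where
  homogeneous : u.IsHomogeneous t
  unit : u ∈ Ideal.span {(X 1 - X 2 : MvPolynomial (Fin 3) K), X 2 - X 0} ^ m
  first : u ∈ Ideal.span {(X 1 : MvPolynomial (Fin 3) K), X 2} ^ a
  second : u ∈ Ideal.span {(X 0 : MvPolynomial (Fin 3) K), X 2} ^ b
  third : u ∈ Ideal.span {(X 0 : MvPolynomial (Fin 3) K), X 1} ^ c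

variable {K}

theorem IsFatPointForm.sub {t m a b c : ℕ} {u v : MvPolynomial (Fin 3) K}
    (hu : IsFatPointForm K t m a b c u) (hv : IsFatPointForm K t m a b c v) :
    IsFatPointForm K t m a b c (u - v) :=
  ⟨hu.1.sub hv.1, sub_mem hu.2 hv.2, sub_mem hu.3 hv.3, sub_mem hu.4 hv.4, sub_mem hu.5 hv.5⟩

theorem span_X_one_X_two_eq :
    Ideal.span {(X 1 : MvPolynomial (Fin 3) K), X 2} = Ideal.span {X 1 - X 2, X 2} :=
  Ideal.span_pair_sub_right _ _ |>.symm

theorem prod_pow_mem_pow {R : Type*} [CommRing R] (I : Ideal R) {x y z : R} {i j k m : ℕ}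
    (hx : x ∈ I) (hy : y ∈ I) (hz : z ∈ I) (h : m ≤ i + j + k) :
    x ^ i * y ^ j * z ^ k ∈ I ^ m := by
  refine Ideal.pow_le_pow_right h ?_
  rw [pow_add, pow_add]
  exact Ideal.mul_mem_mul (Ideal.mul_mem_mul (Ideal.pow_mem_pow hx _) (Ideal.pow_mem_pow hy _))
    (Ideal.pow_mem_pow hz _)

theorem isHomogeneous_of_degree_eq {w : MvPolynomial (Fin 3) K} {t : ℕ}
    (h : ∀ e ∈ w.support, e.degree = t) : w.IsHomogeneous t := by
  intro e he
  have := h e (mem_support_iff.2 he)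
  rwa [Finsupp.degree_eq_weight_one] at this

theorem isHomogeneous_X_sub_X (i j : Fin 3) :
    (X i - X j : MvPolynomial (Fin 3) K).IsHomogeneous 1 :=
  (isHomogeneous_X K i).sub (isHomogeneous_X K j)

theorem isFatPointForm_of_mem_lineProducts {t m a b c : ℕ} {u : MvPolynomial (Fin 3) K}
    (hu : u ∈ lineProducts K t m a b c) : IsFatPointForm K t m a b c u := by
  obtain ⟨i, j, k, p, q, r, ht, hm, ha, hb, hc, rfl⟩ := hu
  unfold lineProduct
  refine ⟨?_, ?_, ?_, ?_, ?_⟩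
  · have := (((((isHomogeneous_X_pow (R := K) (0 : Fin 3) i).mul
      (isHomogeneous_X_pow (1 : Fin 3) j)).mul (isHomogeneous_X_pow (2 : Fin 3) k)).mul
      ((isHomogeneous_X_sub_X 1 2).pow p)).mul ((isHomogeneous_X_sub_X 2 0).pow q)).mul
      ((isHomogeneous_X_sub_X 0 1).pow r)
    convert this using 1
    omega
  · have := Ideal.mul_mem_left _ (X 0 ^ i * X 1 ^ j * X 2 ^ k) (prod_pow_mem_pow
      (Ideal.span {(X 1 - X 2 : MvPolynomial (Fin 3) K), X 2 - X 0})
      (x := X 1 - X 2) (y := X 2 - X 0) (z := X 0 - X 1)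
      (Ideal.mem_span_pair.2 ⟨1, 0, by ring⟩)
      (Ideal.mem_span_pair.2 ⟨0, 1, by ring⟩)
      (Ideal.mem_span_pair.2 ⟨-1, -1, by ring⟩) hm)
    convert this using 1
    ring
  · have := Ideal.mul_mem_left _ (X 0 ^ i * (X 2 - X 0) ^ q * (X 0 - X 1) ^ r) (prod_pow_mem_pow
      (Ideal.span {(X 1 : MvPolynomial (Fin 3) K), X 2})
      (x := X 1) (y := X 2) (z := X 1 - X 2)
      (Ideal.mem_span_pair.2 ⟨1, 0, by ring⟩)
      (Ideal.mem_span_pair.2 ⟨0, 1, by ring⟩)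
      (Ideal.mem_span_pair.2 ⟨1, -1, by ring⟩) ha)
    convert this using 1
    ring
  · have := Ideal.mul_mem_left _ (X 1 ^ j * (X 1 - X 2) ^ p * (X 0 - X 1) ^ r) (prod_pow_mem_pow
      (Ideal.span {(X 0 : MvPolynomial (Fin 3) K), X 2})
      (x := X 0) (y := X 2) (z := X 2 - X 0)
      (Ideal.mem_span_pair.2 ⟨1, 0, by ring⟩)
      (Ideal.mem_span_pair.2 ⟨0, 1, by ring⟩)
      (Ideal.mem_span_pair.2 ⟨-1, 1, by ring⟩) hb)
    convert this using 1
    ring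
  · have := Ideal.mul_mem_left _ (X 2 ^ k * (X 1 - X 2) ^ p * (X 2 - X 0) ^ q) (prod_pow_mem_pow
      (Ideal.span {(X 0 : MvPolynomial (Fin 3) K), X 1})
      (x := X 0) (y := X 1) (z := X 0 - X 1)
      (Ideal.mem_span_pair.2 ⟨1, 0, by ring⟩)
      (Ideal.mem_span_pair.2 ⟨0, 1, by ring⟩)
      (Ideal.mem_span_pair.2 ⟨1, -1, by ring⟩) hc)
    convert this using 1
    ring

theorem isFatPointForm_of_mem_span {t m a b c : ℕ} {u : MvPolynomial (Fin 3) K}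
    (hu : u ∈ Submodule.span K (lineProducts K t m a b c)) : IsFatPointForm K t m a b c u := by
  refine Submodule.span_induction (fun _ => isFatPointForm_of_mem_lineProducts) ?_ ?_ ?_ hu
  · exact ⟨isHomogeneous_zero _ _ _, zero_mem _, zero_mem _, zero_mem _, zero_mem _⟩
  · intro x y _ _ hx hy
    exact ⟨hx.1.add hy.1, add_mem hx.2 hy.2, add_mem hx.3 hy.3, add_mem hx.4 hy.4,
      add_mem hx.5 hy.5⟩
  · intro r x _ hx
    rw [smul_eq_C_mul]
    exact ⟨hx.1.C_mul r, Ideal.mul_mem_left _ _ hx.2, Ideal.mul_mem_left _ _ hx.3,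
      Ideal.mul_mem_left _ _ hx.4, Ideal.mul_mem_left _ _ hx.5⟩

theorem X_sub_X_ne_zero {i j : Fin 3} (hij : i ≠ j) :
    (X i - X j : MvPolynomial (Fin 3) K) ≠ 0 :=
  sub_ne_zero.2 fun h => hij (X_injective h)

/-- Powers of the ideal of a coordinate point are saturated with respect to lines missing it. -/
theorem mem_span_X_pair_pow_of_mul_mem {i j k : Fin 3} (hij : i ≠ j) (hik : i ≠ k) (hjk : j ≠ k)
    {s t : MvPolynomial (Fin 3) K}
    (hs : aeval (fun l => if l = k then (X k : MvPolynomial (Fin 3) K) else 0) s ≠ 0) (m : ℕ)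
    (hst : s * t ∈ Ideal.span {(X i : MvPolynomial (Fin 3) K), X j} ^ m) :
    t ∈ Ideal.span {(X i : MvPolynomial (Fin 3) K), X j} ^ m := by
  refine mem_pow_of_nonzerodivisor_mul_mem (X_ne_zero i) (fun a ha => ?_) (fun a ha => ?_) m hst
  · refine (X_prime.dvd_or_dvd ha).resolve_left fun h => hij ?_
    exact X_dvd_X.1 h
  · refine mem_span_pair_of_mul_mem _ (fun l => ?_) ?_ ?_ hs ha
    · split_ifs with h
      · subst h
        simp
      · rw [sub_zero]
        refine Ideal.subset_span ?_
        have : l = i ∨ l = j := by omega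
        rcases this with rfl | rfl <;> simp
    · simp [hik]
    · simp [hjk]

theorem X_dvd_of_dvd_X_mul {i j : Fin 3} (hij : i ≠ j) (a : MvPolynomial (Fin 3) K)
    (h : X i ∣ X j * a) : X i ∣ a :=
  (X_prime.dvd_or_dvd h).resolve_left fun h' => hij (X_dvd_X.1 h')

theorem line_dvd_sub_aeval (a : MvPolynomial (Fin 3) K) :
    (X 1 - X 2 : MvPolynomial (Fin 3) K) ∣ a - aeval ![X 0, X 2, X 2] a := by
  refine dvd_sub_aeval _ (fun i => ?_) a
  fin_cases i <;> simp

/-- The line `y = z` passes simply through `(1:1:1)` and `(1:0:0)` and misses the other two points,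
so only two multiplicities drop. -/
theorem IsFatPointForm.of_line_mul {t m a b c : ℕ} {v : MvPolynomial (Fin 3) K}
    (h : IsFatPointForm K (t + 1) m a b c ((X 1 - X 2) * v)) :
    IsFatPointForm K t (m - 1) (a - 1) b c v := by
  have hne : (X 1 - X 2 : MvPolynomial (Fin 3) K) ≠ 0 := X_sub_X_ne_zero (by decide)
  have hdvd : ∀ s : MvPolynomial (Fin 3) K, aeval ![X 0, X 2, X 2] s ≠ (0 : MvPolynomial (Fin 3) K) →
      ∀ d, (X 1 - X 2 : MvPolynomial (Fin 3) K) ∣ s * d → X 1 - X 2 ∣ d := by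
    intro s hs d hd
    refine dvd_of_dvd_mul_of_aeval ![X 0, X 2, X 2] (fun i => ?_) ?_ hs hd
    · fin_cases i <;> simp
    · simp
  refine ⟨?_, ?_, ?_, ?_, ?_⟩
  · refine isHomogeneous_of_degree_eq fun e he => ?_
    have := degree_add_eq_of_isHomogeneous_mul hne (isHomogeneous_X_sub_X 1 2) h.1 he
    omega
  · refine mem_pow_pred_of_mul_mem_pow hne (hdvd _ ?_) h.2
    simpa using X_sub_X_ne_zero (by decide)
  · have h3 := h.3
    rw [span_X_one_X_two_eq] at h3 ⊢
    refine mem_pow_pred_of_mul_mem_pow hne (hdvd _ ?_) h3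
    simp
  · refine mem_span_X_pair_pow_of_mul_mem (k := 1) (by decide) (by decide) (by decide) ?_ b h.4
    simp
  · refine mem_span_X_pair_pow_of_mul_mem (k := 2) (by decide) (by decide) (by decide) ?_ c h.5
    simp

theorem IsFatPointForm.of_X_mul {t m a b c : ℕ} {v : MvPolynomial (Fin 3) K}
    (h : IsFatPointForm K (t + 1) m a b c (X 0 * v)) :
    IsFatPointForm K t m a (b - 1) (c - 1) v := by
  refine ⟨?_, ?_, ?_, ?_, ?_⟩
  · refine isHomogeneous_of_degree_eq fun e he => ?_
    have := degree_add_eq_of_isHomogeneous_mul (X_ne_zero 0) (isHomogeneous_X K 0) h.1 he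
    omega
  · refine mem_pow_of_nonzerodivisor_mul_mem (X_sub_X_ne_zero (by decide))
      (fun d hd => ?_) (fun d hd => ?_) m h.2
    · refine dvd_of_dvd_mul_of_aeval ![X 0, X 2, X 2] (fun i => ?_) ?_ ?_ hd
      · fin_cases i <;> simp
      · simp
      · simpa using X_sub_X_ne_zero (by decide)
    · refine mem_span_pair_of_mul_mem ![X 0, X 0, X 0] (fun i => ?_) ?_ ?_ ?_ hd
      · fin_cases i
        · simp
        · exact Ideal.mem_span_pair.2 ⟨1, 1, by simp⟩
        · exact Ideal.mem_span_pair.2 ⟨0, 1, by simp⟩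
      all_goals simp
  · refine mem_span_X_pair_pow_of_mul_mem (k := 0) (by decide) (by decide) (by decide) ?_ a h.3
    simp
  · exact mem_pow_pred_of_mul_mem_pow (X_ne_zero 0) (X_dvd_of_dvd_X_mul (by decide)) h.4
  · exact mem_pow_pred_of_mul_mem_pow (X_ne_zero 0) (X_dvd_of_dvd_X_mul (by decide)) h.5

theorem line_mul_mem_span {t m a b c : ℕ} {v : MvPolynomial (Fin 3) K}
    (hv : v ∈ Submodule.span K (lineProducts K t (m - 1) (a - 1) b c)) :
    (X 1 - X 2) * v ∈ Submodule.span K (lineProducts K (t + 1) m a b c) := by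
  refine Submodule.span_induction ?_ ?_ ?_ ?_ hv
  · rintro _ ⟨i, j, k, p, q, r, ht, hm, ha, hb, hc, rfl⟩
    refine Submodule.subset_span ⟨i, j, k, p + 1, q, r, ?_, ?_, ?_, hb, hc, ?_⟩
    · omega
    · omega
    · omega
    · unfold lineProduct; ring
  · simp
  · intro x y _ _ hx hy
    rw [mul_add]
    exact add_mem hx hy
  · intro r x _ hx
    rw [mul_smul_comm]
    exact Submodule.smul_mem _ _ hx

theorem X_mul_mem_span {t m a b c : ℕ} {v : MvPolynomial (Fin 3) K}
    (hv : v ∈ Submodule.span K (lineProducts K t m a (b - 1) (c - 1))) :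
    X 0 * v ∈ Submodule.span K (lineProducts K (t + 1) m a b c) := by
  refine Submodule.span_induction ?_ ?_ ?_ ?_ hv
  · rintro _ ⟨i, j, k, p, q, r, ht, hm, ha, hb, hc, rfl⟩
    refine Submodule.subset_span ⟨i + 1, j, k, p, q, r, ?_, hm, ha, ?_, ?_, ?_⟩
    · omega
    · omega
    · omega
    · unfold lineProduct; ring
  · simp
  · intro x y _ _ hx hy
    rw [mul_add]
    exact add_mem hx hy
  · intro r x _ hx
    rw [mul_smul_comm]
    exact Submodule.smul_mem _ _ hx

/-- On `y = z` the lines `y` and `z` coincide, as do `z - x` and `x - y` up to sign. Redistributing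
factors within these pairs meets the conditions at `(0:1:0)` and `(0:0:1)` without changing the
restriction. -/
theorem exists_lineProduct_sub_dvd {t m a b c i j k : ℕ} (hbc : b + c ≤ t)
    (ht : i + j + k + a + m = t) :
    ∃ s ∈ Submodule.span K (lineProducts K t m a b c),
      (X 1 - X 2 : MvPolynomial (Fin 3) K) ∣
        X 2 ^ a * (X 2 - X 0) ^ m * (X 0 ^ i * X 1 ^ j * X 2 ^ k) - s := by
  -- `k' + q = b - i` meets the condition at `(0:1:0)` with as few factors as possible; by `b + c ≤
  -- t` the remaining ones suffice at `(0:0:1)`.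
  obtain ⟨q, k', hqm, hk', hq⟩ : ∃ q k', q ≤ m ∧ k' ≤ j + k + a ∧ k' + q = b - i :=
    ⟨min (b - i) m, b - i - min (b - i) m, by omega, by omega, by omega⟩
  refine ⟨(-1 : K) ^ (m - q) • lineProduct K i (j + k + a - k') k' 0 q (m - q),
    Submodule.smul_mem _ _ (Submodule.subset_span
      ⟨i, j + k + a - k', k', 0, q, m - q, ?_, ?_, ?_, ?_, ?_, rfl⟩), ?_⟩
  any_goals omega
  have h := line_dvd_sub_aeval (K := K) (X 2 ^ a * (X 2 - X 0) ^ m * (X 0 ^ i * X 1 ^ j * X 2 ^ k) -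
    (-1 : K) ^ (m - q) • lineProduct K i (j + k + a - k') k' 0 q (m - q))
  suffices h0 : aeval ![X 0, X 2, X 2] (X 2 ^ a * (X 2 - X 0) ^ m * (X 0 ^ i * X 1 ^ j * X 2 ^ k) -
      (-1 : K) ^ (m - q) • lineProduct K i (j + k + a - k') k' 0 q (m - q)) =
      (0 : MvPolynomial (Fin 3) K) by
    rwa [h0, sub_zero] at h
  rw [smul_eq_C_mul]
  simp only [lineProduct, map_sub, map_mul, map_pow, aeval_X, map_neg, map_one,
    Matrix.cons_val_zero, Matrix.cons_val_one, Matrix.cons_val, pow_zero, mul_one]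
  have e1 : (X 2 : MvPolynomial (Fin 3) K) ^ (j + k + a - k') * X 2 ^ k' =
      X 2 ^ j * X 2 ^ k * X 2 ^ a := by
    rw [← pow_add, ← pow_add, ← pow_add, Nat.sub_add_cancel hk']
  have e2 : (-1 : MvPolynomial (Fin 3) K) ^ (m - q) * ((X 2 - X 0) ^ q * (X 0 - X 2) ^ (m - q)) =
      (X 2 - X 0) ^ m := by
    rw [mul_left_comm, ← mul_pow, show (-1 : MvPolynomial (Fin 3) K) * (X 0 - X 2) = X 2 - X 0 by
      ring, ← pow_add, Nat.add_sub_cancel' hqm]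
  rw [← e2]
  linear_combination (-(X 0 : MvPolynomial (Fin 3) K) ^ i * (-1) ^ (m - q) *
    ((X 2 - X 0) ^ q * (X 0 - X 2) ^ (m - q))) * e1

theorem eq_zero_of_forall_mem_support {w : MvPolynomial (Fin 3) K}
    (h : ∀ e ∈ w.support, False) : w = 0 := by
  rw [← support_eq_empty]
  exact Finset.eq_empty_of_forall_notMem h

theorem X_two_not_dvd_sub_X_zero : ¬ (X 2 : MvPolynomial (Fin 3) K) ∣ X 2 - X 0 := by
  rw [dvd_sub_right dvd_rfl, X_dvd_X]
  decide

theorem IsFatPointForm.exists_sub_dvd {t m a b c : ℕ} {u : MvPolynomial (Fin 3) K}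
    (hu : IsFatPointForm K t m a b c u) (hbc : b + c ≤ t) :
    ∃ s ∈ Submodule.span K (lineProducts K t m a b c),
      (X 1 - X 2 : MvPolynomial (Fin 3) K) ∣ u - s := by
  have h3 := hu.first
  rw [span_X_one_X_two_eq] at h3
  obtain ⟨w, hw⟩ := exists_aeval_eq_pow_mul_pow_mul ![X 0, X 2, X 2] (by simp) (by simp) (by simp)
    (X_prime (i := (2 : Fin 3))) X_two_not_dvd_sub_X_zero h3 hu.unit
  have hhom : (X 2 ^ a * (X 2 - X 0) ^ m * w : MvPolynomial (Fin 3) K).IsHomogeneous t := by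
    rw [← hw, ← one_mul t]
    refine hu.homogeneous.aeval _ fun i => ?_
    fin_cases i <;> simpa using isHomogeneous_X K _
  have hcne : (X 2 ^ a * (X 2 - X 0) ^ m : MvPolynomial (Fin 3) K) ≠ 0 :=
    mul_ne_zero (pow_ne_zero _ (X_ne_zero _)) (pow_ne_zero _ (X_sub_X_ne_zero (by decide)))
  have hchom : (X 2 ^ a * (X 2 - X 0) ^ m : MvPolynomial (Fin 3) K).IsHomogeneous (a + m) := by
    simpa using (isHomogeneous_X_pow (R := K) (2 : Fin 3) a).mul ((isHomogeneous_X_sub_X 2 0).pow m)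
  let V := Submodule.span K (lineProducts K t m a b c)
  let W := (Ideal.span {(X 1 - X 2 : MvPolynomial (Fin 3) K)}).restrictScalars K
  have hmem : X 2 ^ a * (X 2 - X 0) ^ m * w ∈ V ⊔ W := by
    rw [w.as_sum, Finset.mul_sum]
    refine sum_mem fun e he => ?_
    have hdeg := degree_add_eq_of_isHomogeneous_mul hcne hchom hhom he
    have hmon : monomial e (coeff e w) = coeff e w • (X 0 ^ e 0 * X 1 ^ e 1 * X 2 ^ e 2) := by
      rw [monomial_eq, smul_eq_C_mul, Finsupp.prod_fintype _ _ (by simp), Fin.prod_univ_three]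
    rw [hmon, mul_smul_comm]
    refine Submodule.smul_mem _ _ ?_
    rw [Finsupp.degree_eq_sum, Fin.sum_univ_three] at hdeg
    obtain ⟨s, hs, hd⟩ := exists_lineProduct_sub_dvd (K := K) (m := m) (a := a) hbc
      (i := e 0) (j := e 1) (k := e 2) (by omega)
    exact Submodule.mem_sup.2 ⟨s, hs, _, Ideal.mem_span_singleton.2 hd, by ring⟩
  obtain ⟨s, hs, d, hd, hsd⟩ := Submodule.mem_sup.1 hmem
  refine ⟨s, hs, ?_⟩
  have h1 := line_dvd_sub_aeval u
  rw [hw, ← hsd] at h1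
  have := dvd_add h1 (Ideal.mem_span_singleton.1 hd)
  convert this using 1
  ring

/-- Bézout: on the line `x = 0` the form has two zeros whose multiplicities add up to more than its
degree. -/
theorem IsFatPointForm.X_zero_dvd {t m a b c : ℕ} {u : MvPolynomial (Fin 3) K}
    (hu : IsFatPointForm K t m a b c u) (hbc : t < b + c) : X 0 ∣ u := by
  obtain ⟨w, hw⟩ := exists_aeval_eq_pow_mul_pow_mul ![0, X 1, X 2] (by simp) (by simp) (by simp)
    (X_prime (i := (2 : Fin 3))) (by rw [X_dvd_X]; decide) hu.second hu.third
  have hhom : (X 2 ^ b * X 1 ^ c * w : MvPolynomial (Fin 3) K).IsHomogeneous t := by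
    rw [← hw, ← one_mul t]
    refine hu.homogeneous.aeval _ fun i => ?_
    fin_cases i
    · simpa using isHomogeneous_zero _ _ _
    · simpa using isHomogeneous_X K _
    · simpa using isHomogeneous_X K _
  have hw0 : w = 0 := by
    refine eq_zero_of_forall_mem_support fun e he => ?_
    have := degree_add_eq_of_isHomogeneous_mul
      (mul_ne_zero (pow_ne_zero _ (X_ne_zero _)) (pow_ne_zero _ (X_ne_zero _)))
      ((isHomogeneous_X_pow (R := K) (2 : Fin 3) b).mul (isHomogeneous_X_pow (1 : Fin 3) c)) hhom he
    omega
  have h1 : X 0 ∣ u - aeval ![0, X 1, X 2] u := by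
    refine dvd_sub_aeval _ (fun i => ?_) u
    fin_cases i <;> simp
  rwa [hw, hw0, mul_zero, sub_zero] at h1

/-- The fat point forms at four general points of the plane are spanned by products of lines. -/
theorem IsFatPointForm.mem_span {t m a b c : ℕ} {u : MvPolynomial (Fin 3) K}
    (hu : IsFatPointForm K t m a b c u) :
    u ∈ Submodule.span K (lineProducts K t m a b c) := by
  -- If `t < b + c`, the line `x = 0` splits off. Otherwise a combination of line products has the
  -- same restriction to `y = z`, and that line splits off the difference. Either way the degree
  -- drops.
  induction t generalizing m a b c u with
  | zero =>
    rcases Nat.lt_or_ge 0 (b + c) with hbc | hbc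
    · obtain ⟨v, rfl⟩ := hu.X_zero_dvd hbc
      have : v = 0 := by
        refine eq_zero_of_forall_mem_support fun e he => ?_
        have := degree_add_eq_of_isHomogeneous_mul (X_ne_zero 0) (isHomogeneous_X K 0) hu.1 he
        omega
      simp [this]
    · obtain ⟨s, hs, v, hv⟩ := hu.exists_sub_dvd hbc
      have hsub := hu.sub (isFatPointForm_of_mem_span hs)
      rw [hv] at hsub
      have : v = 0 := by
        refine eq_zero_of_forall_mem_support fun e he => ?_
        have := degree_add_eq_of_isHomogeneous_mul (X_sub_X_ne_zero (by decide))
          (isHomogeneous_X_sub_X 1 2) hsub.1 he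
        omega
      rw [this, mul_zero, sub_eq_zero] at hv
      rwa [hv]
  | succ t ih =>
    rcases Nat.lt_or_ge (t + 1) (b + c) with hbc | hbc
    · obtain ⟨v, rfl⟩ := hu.X_zero_dvd hbc
      exact X_mul_mem_span (ih hu.of_X_mul)
    · obtain ⟨s, hs, v, hv⟩ := hu.exists_sub_dvd hbc
      have hsub := hu.sub (isFatPointForm_of_mem_span hs)
      rw [hv] at hsub
      rw [sub_eq_iff_eq_add.1 hv]
      exact add_mem (line_mul_mem_span (ih hsub.of_line_mul)) hs

end LineProducts
-- Coordinates over the subring of polynomials in `xⁿ, yⁿ, zⁿ`.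
section Residues

variable {K : Type*} [Field K] {n : ℕ}

/-- The coordinates of `K[x, y, z]` over `K[xⁿ, yⁿ, zⁿ]`. -/
noncomputable def residueCoord (K : Type*) [Field K] (n : ℕ) (ε : Fin 3 → Fin n) :
    MvPolynomial (Fin 3) K →ₗ[K] MvPolynomial (Fin 3) K :=
  (basisMonomials (Fin 3) K).constr K fun e =>
    if ∀ i, e i % n = ε i then monomial (e.mapRange (· / n) (Nat.zero_div n)) 1 else 0

theorem residueCoord_monomial (ε : Fin 3 → Fin n) (e : Fin 3 →₀ ℕ) (r : K) :
    residueCoord K n ε (monomial e r) =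
      if ∀ i, e i % n = ε i then monomial (e.mapRange (· / n) (Nat.zero_div n)) r else 0 := by
  have h : monomial e r = r • basisMonomials (Fin 3) K e := by
    rw [coe_basisMonomials, smul_monomial, smul_eq_mul, mul_one]
  rw [h, map_smul, residueCoord, Module.Basis.constr_basis, smul_ite, smul_zero, smul_monomial,
    smul_eq_mul, mul_one]

variable [NeZero n]

theorem residueCoord_expand_mul (ε : Fin 3 → Fin n) (s u : MvPolynomial (Fin 3) K) :
    residueCoord K n ε (expand n s * u) = s * residueCoord K n ε u := by
  induction s using MvPolynomial.induction_on' with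
  | add p q hp hq => rw [map_add, add_mul, map_add, hp, hq, add_mul]
  | monomial d r =>
    induction u using MvPolynomial.induction_on' with
    | add p q hp hq => rw [mul_add, map_add, hp, hq, map_add, mul_add]
    | monomial e r' =>
      have hn : 0 < n := Nat.pos_of_ne_zero (NeZero.ne n)
      rw [expand_monomial, monomial_mul, residueCoord_monomial, residueCoord_monomial]
      have hiff : (∀ i, (n • d + e) i % n = ε i) ↔ ∀ i, e i % n = ε i := by
        simp
      simp only [hiff]
      split_ifs with h
      · rw [monomial_mul]
        congr 2
        ext i
        simp [Nat.mul_add_div hn]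
      · rw [mul_zero]

theorem sum_residueCoord (u : MvPolynomial (Fin 3) K) :
    u = ∑ ε : Fin 3 → Fin n,
      X 0 ^ (ε 0 : ℕ) * X 1 ^ (ε 1 : ℕ) * X 2 ^ (ε 2 : ℕ) * expand n (residueCoord K n ε u) := by
  have hn : 0 < n := Nat.pos_of_ne_zero (NeZero.ne n)
  induction u using MvPolynomial.induction_on' with
  | add p q hp hq =>
    conv_lhs => rw [hp, hq]
    rw [← Finset.sum_add_distrib]
    refine Finset.sum_congr rfl fun ε _ => ?_
    rw [map_add, map_add, mul_add]
  | monomial e r =>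
    rw [Finset.sum_eq_single (fun i => ⟨e i % n, Nat.mod_lt _ hn⟩)]
    · rw [residueCoord_monomial, if_pos (fun i => rfl), expand_monomial, monomial_eq, monomial_eq,
        Finsupp.prod_fintype _ _ (by simp), Finsupp.prod_fintype _ _ (by simp), Fin.prod_univ_three,
        Fin.prod_univ_three]
      have h : ∀ i : Fin 3, (X i : MvPolynomial (Fin 3) K) ^ e i =
          X i ^ (e i % n) * X i ^ (n * (e i / n)) := fun i => by
        rw [← pow_add, Nat.mod_add_div]
      simp only [Finsupp.smul_apply, Finsupp.mapRange_apply, smul_eq_mul]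
      rw [h 0, h 1, h 2]
      ring
    · intro ε _ hε
      rw [residueCoord_monomial, if_neg, map_zero, mul_zero]
      intro h
      exact hε (funext fun i => Fin.ext (h i).symm)
    · simp

theorem residueCoord_mem_of_mem_map {I : Ideal (MvPolynomial (Fin 3) K)}
    {u : MvPolynomial (Fin 3) K} (hu : u ∈ I.map (expand n (σ := Fin 3) (R := K)))
    (ε : Fin 3 → Fin n) : residueCoord K n ε u ∈ I := by
  -- The multiplier `r` is carried along because `residueCoord` is linear only over the subring.
  refine Submodule.span_induction (p := fun u _ => ∀ r, residueCoord K n ε (u * r) ∈ I)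
    ?_ ?_ ?_ ?_ hu |> fun h => by simpa using h 1
  · rintro _ ⟨s, hs, rfl⟩ r
    exact (residueCoord_expand_mul ε s r).symm ▸ I.mul_mem_right _ hs
  · intro r
    simp
  · intro x y _ _ hx hy r
    rw [add_mul, map_add]
    exact add_mem (hx r) (hy r)
  · intro b x _ hx r
    have : b • x * r = x * (b * r) := by rw [smul_eq_mul]; ring
    rw [this]
    exact hx _

theorem mem_map_expand_of_residueCoord_mem {I : Ideal (MvPolynomial (Fin 3) K)}
    {u : MvPolynomial (Fin 3) K} (hu : ∀ ε : Fin 3 → Fin n, residueCoord K n ε u ∈ I) :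
    u ∈ I.map (expand n (σ := Fin 3) (R := K)) := by
  rw [sum_residueCoord (n := n) u]
  exact sum_mem fun ε _ => Ideal.mul_mem_left _ _ (Ideal.mem_map_of_mem _ (hu ε))

/-- A monomial with residues `ε` has exponents `ε i + n a` and `ε j + n b`; their sum being at least
`m` says that `a + b` is at least the stated ceiling. -/
theorem residueCoord_mem_span_X_pair_pow {i j : Fin 3} (hij : i ≠ j) {m : ℕ}
    {u : MvPolynomial (Fin 3) K}
    (hu : u ∈ Ideal.span {(X i : MvPolynomial (Fin 3) K), X j} ^ m) (ε : Fin 3 → Fin n) :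
    residueCoord K n ε u ∈ Ideal.span {(X i : MvPolynomial (Fin 3) K), X j} ^
      ((m - ε i - ε j) ⌈/⌉ n) := by
  have hn : 0 < n := Nat.pos_of_ne_zero (NeZero.ne n)
  rw [span_pair_pow] at hu
  refine Submodule.span_induction (p := fun u _ => ∀ r, residueCoord K n ε (u * r) ∈ _)
    ?_ ?_ ?_ ?_ hu |> fun h => by simpa using h 1
  · rintro _ ⟨a, b, hab, rfl⟩ r
    induction r using MvPolynomial.induction_on' with
    | add p q hp hq =>
      rw [mul_add, map_add]
      exact add_mem hp hq
    | monomial e c =>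
      have hmon : (X i : MvPolynomial (Fin 3) K) ^ a * X j ^ b * monomial e c =
          monomial (Finsupp.single i a + Finsupp.single j b + e) c := by
        rw [X_pow_eq_monomial, X_pow_eq_monomial, monomial_mul, monomial_mul, one_mul, one_mul]
      rw [hmon, residueCoord_monomial]
      split_ifs with h
      · set d := (Finsupp.single i a + Finsupp.single j b + e) with hd
        have hi : a ≤ d i := by simp [hd, hij]
        have hj : b ≤ d j := by simp [hd, hij.symm]
        have hle : (m - ε i - ε j) ⌈/⌉ n ≤ d i / n + d j / n := by
          rw [ceilDiv_le_iff_le_mul hn, mul_add]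
          have h1 := Nat.div_add_mod (d i) n
          have h2 := Nat.div_add_mod (d j) n
          rw [h] at h1 h2
          omega
        refine Ideal.pow_le_pow_right hle ?_
        have hsplit : d.mapRange (· / n) (Nat.zero_div n) = Finsupp.single i (d i / n) +
            Finsupp.single j (d j / n) +
              (d.mapRange (· / n) (Nat.zero_div n) - Finsupp.single i (d i / n) -
                Finsupp.single j (d j / n)) := by
          ext l
          by_cases hl : l = i
          · subst hl
            simp [hij]
          · by_cases hl' : l = j
            · subst hl'
              simp [hij.symm]
            · simp [Ne.symm hl, Ne.symm hl']
        rw [hsplit, ← one_mul c, ← monomial_mul]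
        refine Ideal.mul_mem_right _ _ ?_
        rw [← one_mul (1 : K), ← monomial_mul, ← X_pow_eq_monomial, ← X_pow_eq_monomial, pow_add]
        exact Ideal.mul_mem_mul (Ideal.pow_mem_pow (Ideal.subset_span (by simp)) _)
          (Ideal.pow_mem_pow (Ideal.subset_span (by simp)) _)
      · exact zero_mem _
  · intro r
    simp
  · intro x y _ _ hx hy r
    rw [add_mul, map_add]
    exact add_mem (hx r) (hy r)
  · intro b x _ hx r
    have : b • x * r = x * (b * r) := by rw [smul_eq_mul]; ring
    rw [this]
    exact hx _

end Residues
-- Generators of the fat ideal and reduction of their degrees.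
section FermatProducts

variable (K : Type*) [Field K]

/-- Products of coordinates and of the forms `yⁿ - zⁿ`, `zⁿ - xⁿ`, `xⁿ - yⁿ`. -/
noncomputable def fermatProduct (n i j k p q r : ℕ) : MvPolynomial (Fin 3) K :=
  X 0 ^ i * X 1 ^ j * X 2 ^ k * (X 1 ^ n - X 2 ^ n) ^ p * (X 2 ^ n - X 0 ^ n) ^ q *
    (X 0 ^ n - X 1 ^ n) ^ r

/-- The exponents of the products vanishing to order `m` on the Fermat configuration. -/
def IsAdmissible (n m i j k p q r : ℕ) : Prop :=
  m ≤ p + q + r ∧ m ≤ j + k + n * p ∧ m ≤ i + k + n * q ∧ m ≤ i + j + n * r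

/-- The ideal of polynomials vanishing to order `m` on the Fermat configuration. -/
noncomputable def fermatFatIdeal (n m : ℕ) : Ideal (MvPolynomial (Fin 3) K) :=
  Ideal.span {X 1 ^ n - X 2 ^ n, X 2 ^ n - X 0 ^ n} ^ m ⊓
    (Ideal.span {X 1, X 2} ^ m ⊓ (Ideal.span {X 0, X 2} ^ m ⊓ Ideal.span {X 0, X 1} ^ m))

/-- Admissible products with `m` factors `xⁿ - yⁿ` and at most `m` coordinate factors. -/
def fermatGenerators (n m : ℕ) : Set (MvPolynomial (Fin 3) K) :=
  {u | ∃ i j k p q r, IsAdmissible n m i j k p q r ∧ p + q + r = m ∧ i + j + k ≤ m ∧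
    u = fermatProduct K n i j k p q r}

variable {K}

theorem isHomogeneous_X_pow_sub_X_pow (i j : Fin 3) (n : ℕ) :
    (X i ^ n - X j ^ n : MvPolynomial (Fin 3) K).IsHomogeneous n :=
  (isHomogeneous_X_pow i n).sub (isHomogeneous_X_pow j n)

theorem isHomogeneous_fermatProduct (n i j k p q r : ℕ) :
    (fermatProduct K n i j k p q r).IsHomogeneous (i + j + k + n * (p + q + r)) := by
  unfold fermatProduct
  have := (((((isHomogeneous_X_pow (R := K) (0 : Fin 3) i).mul
    (isHomogeneous_X_pow (1 : Fin 3) j)).mul (isHomogeneous_X_pow (2 : Fin 3) k)).mul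
    ((isHomogeneous_X_pow_sub_X_pow 1 2 n).pow p)).mul
    ((isHomogeneous_X_pow_sub_X_pow 2 0 n).pow q)).mul
    ((isHomogeneous_X_pow_sub_X_pow 0 1 n).pow r)
  convert this using 1
  ring

theorem finite_fermatGenerators (n m : ℕ) : (fermatGenerators K n m).Finite := by
  refine (Set.finite_range fun v : Fin 6 → Fin (m + 1) =>
    fermatProduct K n (v 0) (v 1) (v 2) (v 3) (v 4) (v 5)).subset ?_
  rintro _ ⟨i, j, k, p, q, r, _, hm, hd, rfl⟩
  exact ⟨![⟨i, by omega⟩, ⟨j, by omega⟩, ⟨k, by omega⟩, ⟨p, by omega⟩, ⟨q, by omega⟩,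
    ⟨r, by omega⟩], rfl⟩

theorem exists_isHomogeneous_of_mem_fermatGenerators {n m : ℕ} {u : MvPolynomial (Fin 3) K}
    (hu : u ∈ fermatGenerators K n m) : ∃ c ≤ m * (n + 1), u.IsHomogeneous c := by
  obtain ⟨i, j, k, p, q, r, _, hm, hd, rfl⟩ := hu
  refine ⟨_, ?_, isHomogeneous_fermatProduct n i j k p q r⟩
  rw [hm]
  nlinarith

theorem X_pow_sub_X_pow_mem (i j : Fin 3) {n : ℕ} {I : Ideal (MvPolynomial (Fin 3) K)}
    (hi : X i ∈ I) (hj : X j ∈ I) : (X i ^ n - X j ^ n : MvPolynomial (Fin 3) K) ∈ I ^ n :=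
  sub_mem (Ideal.pow_mem_pow hi n) (Ideal.pow_mem_pow hj n)

theorem prod_pow_pow_mem_pow {R : Type*} [CommRing R] (I : Ideal R) {x y z : R} {i j n k m : ℕ}
    (hx : x ∈ I) (hy : y ∈ I) (hz : z ∈ I ^ n) (h : m ≤ i + j + n * k) :
    x ^ i * y ^ j * z ^ k ∈ I ^ m := by
  refine Ideal.pow_le_pow_right h ?_
  rw [pow_add, pow_add, pow_mul]
  exact Ideal.mul_mem_mul (Ideal.mul_mem_mul (Ideal.pow_mem_pow hx _) (Ideal.pow_mem_pow hy _))
    (Ideal.pow_mem_pow hz _)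

theorem fermatProduct_mem_fermatFatIdeal {n m i j k p q r : ℕ}
    (h : IsAdmissible n m i j k p q r) : fermatProduct K n i j k p q r ∈ fermatFatIdeal K n m := by
  obtain ⟨hm, ha, hb, hc⟩ := h
  have hX : ∀ i j : Fin 3, ∀ l ∈ ({i, j} : Set (Fin 3)),
      X l ∈ Ideal.span {(X i : MvPolynomial (Fin 3) K), X j} := by
    rintro i j l (rfl | rfl) <;> exact Ideal.subset_span (by simp)
  unfold fermatProduct
  refine Ideal.mem_inf.2 ⟨?_, Ideal.mem_inf.2 ⟨?_, Ideal.mem_inf.2 ⟨?_, ?_⟩⟩⟩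
  · have := Ideal.mul_mem_left _ (X 0 ^ i * X 1 ^ j * X 2 ^ k) (prod_pow_mem_pow
      (Ideal.span {(X 1 ^ n - X 2 ^ n : MvPolynomial (Fin 3) K), X 2 ^ n - X 0 ^ n})
      (x := X 1 ^ n - X 2 ^ n) (y := X 2 ^ n - X 0 ^ n) (z := X 0 ^ n - X 1 ^ n)
      (Ideal.mem_span_pair.2 ⟨1, 0, by ring⟩)
      (Ideal.mem_span_pair.2 ⟨0, 1, by ring⟩)
      (Ideal.mem_span_pair.2 ⟨-1, -1, by ring⟩) hm)
    convert this using 1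
    ring
  · have := Ideal.mul_mem_left _ (X 0 ^ i * (X 2 ^ n - X 0 ^ n) ^ q * (X 0 ^ n - X 1 ^ n) ^ r)
      (prod_pow_pow_mem_pow _ (hX 1 2 1 (by simp)) (hX 1 2 2 (by simp))
        (X_pow_sub_X_pow_mem 1 2 (hX 1 2 1 (by simp)) (hX 1 2 2 (by simp))) ha)
    convert this using 1
    ring
  · have := Ideal.mul_mem_left _ (X 1 ^ j * (X 1 ^ n - X 2 ^ n) ^ p * (X 0 ^ n - X 1 ^ n) ^ r)
      (prod_pow_pow_mem_pow _ (hX 0 2 0 (by simp)) (hX 0 2 2 (by simp))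
        (X_pow_sub_X_pow_mem 2 0 (hX 0 2 2 (by simp)) (hX 0 2 0 (by simp))) hb)
    convert this using 1
    ring
  · have := Ideal.mul_mem_left _ (X 2 ^ k * (X 1 ^ n - X 2 ^ n) ^ p * (X 2 ^ n - X 0 ^ n) ^ q)
      (prod_pow_pow_mem_pow _ (hX 0 1 0 (by simp)) (hX 0 1 1 (by simp))
        (X_pow_sub_X_pow_mem 0 1 (hX 0 1 0 (by simp)) (hX 0 1 1 (by simp))) hc)
    convert this using 1
    ring

theorem homogeneousComponent_mem_span_pair_pow {u v w : MvPolynomial (Fin 3) K} {d e : ℕ}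
    (hu : u.IsHomogeneous d) (hv : v.IsHomogeneous e) {m : ℕ} (hw : w ∈ Ideal.span {u, v} ^ m)
    (t : ℕ) : homogeneousComponent t w ∈ Ideal.span {u, v} ^ m := by
  rw [span_pair_pow] at hw ⊢
  refine Ideal.span_mono (fun s hs => hs.1) (homogeneousComponent_mem_span ?_ hw t)
  rintro _ ⟨i, j, _, rfl⟩
  exact ⟨_, (hu.pow i).mul (hv.pow j)⟩

theorem map_expand_span_pair (n : ℕ) :
    (Ideal.span {(X 1 - X 2 : MvPolynomial (Fin 3) K), X 2 - X 0}).map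
      (expand n (σ := Fin 3) (R := K)) =
        Ideal.span {X 1 ^ n - X 2 ^ n, X 2 ^ n - X 0 ^ n} := by
  rw [Ideal.map_span, Set.image_pair]
  simp

theorem mem_span_fermatProduct {n m : ℕ} [NeZero n] {u : MvPolynomial (Fin 3) K}
    (hu : u ∈ fermatFatIdeal K n m) :
    u ∈ Ideal.span {w | ∃ i j k p q r, IsAdmissible n m i j k p q r ∧
      w = fermatProduct K n i j k p q r} := by
  have hn : 0 < n := Nat.pos_of_ne_zero (NeZero.ne n)
  obtain ⟨h1, h2, h3, h4⟩ := hu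
  rw [sum_residueCoord (n := n) u]
  refine sum_mem fun ε _ => ?_
  rw [SetLike.mem_coe, ← map_expand_span_pair, ← Ideal.map_pow] at h1
  have c1 := residueCoord_mem_of_mem_map h1 ε
  have c2 := residueCoord_mem_span_X_pair_pow (by decide) h2 ε
  have c3 := residueCoord_mem_span_X_pair_pow (by decide) h3 ε
  have c4 := residueCoord_mem_span_X_pair_pow (by decide) h4 ε
  rw [← sum_homogeneousComponent (residueCoord K n ε u), map_sum, Finset.mul_sum]
  refine sum_mem fun t _ => ?_
  have hform : IsFatPointForm K t m ((m - ε 1 - ε 2) ⌈/⌉ n) ((m - ε 0 - ε 2) ⌈/⌉ n)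
      ((m - ε 0 - ε 1) ⌈/⌉ n) (homogeneousComponent t (residueCoord K n ε u)) :=
    ⟨homogeneousComponent_isHomogeneous _ _,
      homogeneousComponent_mem_span_pair_pow (isHomogeneous_X_sub_X 1 2)
        (isHomogeneous_X_sub_X 2 0) c1 t,
      homogeneousComponent_mem_span_pair_pow (isHomogeneous_X K 1) (isHomogeneous_X K 2) c2 t,
      homogeneousComponent_mem_span_pair_pow (isHomogeneous_X K 0) (isHomogeneous_X K 2) c3 t,
      homogeneousComponent_mem_span_pair_pow (isHomogeneous_X K 0) (isHomogeneous_X K 1) c4 t⟩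
  refine Submodule.span_induction ?_ ?_ ?_ ?_ hform.mem_span
  -- Multiplying back by the residue monomial turns the ceiling bounds into admissibility.
  · rintro _ ⟨i, j, k, p, q, r, -, hm, ha, hb, hc, rfl⟩
    refine Ideal.subset_span ⟨ε 0 + n * i, ε 1 + n * j, ε 2 + n * k, p, q, r, ⟨hm, ?_, ?_, ?_⟩, ?_⟩
    · rw [ceilDiv_le_iff_le_mul hn, mul_add, mul_add] at ha
      omega
    · rw [ceilDiv_le_iff_le_mul hn, mul_add, mul_add] at hb
      omega
    · rw [ceilDiv_le_iff_le_mul hn, mul_add, mul_add] at hc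
      omega
    · simp only [lineProduct, fermatProduct, map_mul, map_pow, map_sub, expand_X, pow_add, pow_mul]
      ring
  · simp
  · intro x y _ _ hx hy
    rw [map_add, mul_add]
    exact add_mem hx hy
  · intro r x _ hx
    rw [map_smul, mul_smul_comm, smul_eq_C_mul]
    exact Ideal.mul_mem_left _ _ hx

/-- Writing `yⁿ - zⁿ = y·yⁿ⁻¹ - z·zⁿ⁻¹` trades one factor for `n - 1` coordinate factors, which
lowers the degree by one. -/
theorem fermatProduct_mem_of_first {n i j k p q r : ℕ} (hn : 0 < n)
    {I : Ideal (MvPolynomial (Fin 3) K)} (h1 : fermatProduct K n i (j + (n - 1)) k p q r ∈ I)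
    (h2 : fermatProduct K n i j (k + (n - 1)) p q r ∈ I) :
    fermatProduct K n i j k (p + 1) q r ∈ I := by
  have hX : ∀ i : Fin 3, (X i : MvPolynomial (Fin 3) K) ^ n = X i * X i ^ (n - 1) := fun i => by
    rw [mul_pow_sub_one hn.ne']
  have := sub_mem (I.mul_mem_left (X 1) h1) (I.mul_mem_left (X 2) h2)
  convert this using 1
  simp only [fermatProduct, pow_add, pow_one]
  linear_combination (X 0 ^ i * X 1 ^ j * X 2 ^ k * (X 1 ^ n - X 2 ^ n) ^ p *
    (X 2 ^ n - X 0 ^ n) ^ q * (X 0 ^ n - X 1 ^ n) ^ r) * (hX 1 - hX 2)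

theorem fermatProduct_mem_of_second {n i j k p q r : ℕ} (hn : 0 < n)
    {I : Ideal (MvPolynomial (Fin 3) K)} (h1 : fermatProduct K n i j (k + (n - 1)) p q r ∈ I)
    (h2 : fermatProduct K n (i + (n - 1)) j k p q r ∈ I) :
    fermatProduct K n i j k p (q + 1) r ∈ I := by
  have hX : ∀ i : Fin 3, (X i : MvPolynomial (Fin 3) K) ^ n = X i * X i ^ (n - 1) := fun i => by
    rw [mul_pow_sub_one hn.ne']
  have := sub_mem (I.mul_mem_left (X 2) h1) (I.mul_mem_left (X 0) h2)
  convert this using 1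
  simp only [fermatProduct, pow_add, pow_one]
  linear_combination (X 0 ^ i * X 1 ^ j * X 2 ^ k * (X 1 ^ n - X 2 ^ n) ^ p *
    (X 2 ^ n - X 0 ^ n) ^ q * (X 0 ^ n - X 1 ^ n) ^ r) * (hX 2 - hX 0)

theorem fermatProduct_mem_of_third {n i j k p q r : ℕ} (hn : 0 < n)
    {I : Ideal (MvPolynomial (Fin 3) K)} (h1 : fermatProduct K n (i + (n - 1)) j k p q r ∈ I)
    (h2 : fermatProduct K n i (j + (n - 1)) k p q r ∈ I) :
    fermatProduct K n i j k p q (r + 1) ∈ I := by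
  have hX : ∀ i : Fin 3, (X i : MvPolynomial (Fin 3) K) ^ n = X i * X i ^ (n - 1) := fun i => by
    rw [mul_pow_sub_one hn.ne']
  have := sub_mem (I.mul_mem_left (X 0) h1) (I.mul_mem_left (X 1) h2)
  convert this using 1
  simp only [fermatProduct, pow_add, pow_one]
  linear_combination (X 0 ^ i * X 1 ^ j * X 2 ^ k * (X 1 ^ n - X 2 ^ n) ^ p *
    (X 2 ^ n - X 0 ^ n) ^ q * (X 0 ^ n - X 1 ^ n) ^ r) * (hX 0 - hX 1)

/-- The hypotheses force two of the three coordinate-point conditions to be equalities. The three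
left sides add up to `2(i+j+k) + N`, so the third is at least `N + 2 ≥ 2m + n`. -/
theorem exists_large_exponent {n m i j k P Q R N : ℕ} (ha : m ≤ j + k + P) (hb : m ≤ i + k + Q)
    (hsum : P + Q + R = N) (hprod : 2 * m + n ≤ N + 2) (hN : 3 * m ≤ N)
    (hijk : m < i + j + k) (hx : i = 0 ∨ i + k + Q = m ∨ i + j + R = m)
    (hy : j = 0 ∨ j + k + P = m ∨ i + j + R = m) (hz : k = 0 ∨ j + k + P = m ∨ i + k + Q = m) :
    (0 < j ∧ 0 < k ∧ 0 < P ∧ m + n + 1 ≤ j + k + P) ∨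
      (0 < i ∧ 0 < k ∧ 0 < Q ∧ m + n + 1 ≤ i + k + Q) ∨
        (0 < i ∧ 0 < j ∧ 0 < R ∧ m + n + 1 ≤ i + j + R) := by
  by_cases h1 : j + k + P = m
  · by_cases h2 : i + k + Q = m
    · right; right
      omega
    · right; left
      omega
  · left
    omega

/-- Every admissible product lies in the ideal of the generators of degree at most `m * (n + 1)`. -/
theorem fermatProduct_mem_span_fermatGenerators {n m : ℕ} (hn : 3 ≤ n) (hm1 : 1 ≤ m)
    {i j k p q r : ℕ} (h : IsAdmissible n m i j k p q r) :
    fermatProduct K n i j k p q r ∈ Ideal.span (fermatGenerators K n m) := by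
  induction hd : i + j + k + n * p + n * q + n * r using Nat.strong_induction_on
    generalizing i j k p q r with
  | _ d ih =>
  subst hd
  have ih' : ∀ {i' j' k' p' q' r' : ℕ}, IsAdmissible n m i' j' k' p' q' r' →
      i' + j' + k' + n * p' + n * q' + n * r' < i + j + k + n * p + n * q + n * r →
      fermatProduct K n i' j' k' p' q' r' ∈ Ideal.span (fermatGenerators K n m) :=
    fun h' hlt => ih _ hlt h' rfl
  clear ih
  have hnm : 3 * m ≤ n * m := Nat.mul_le_mul_right m hn
  -- A superfluous coordinate factor is dropped; afterwards every coordinate present occurs in a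
  -- tight condition.
  by_cases hx : 0 < i ∧ IsAdmissible n m (i - 1) j k p q r
  · obtain ⟨i, rfl⟩ := Nat.exists_eq_add_one.2 hx.1
    have := Ideal.mul_mem_left _ (X 0) (ih' hx.2 (by omega))
    convert this using 1
    simp only [fermatProduct, Nat.add_sub_cancel]
    ring
  by_cases hy : 0 < j ∧ IsAdmissible n m i (j - 1) k p q r
  · obtain ⟨j, rfl⟩ := Nat.exists_eq_add_one.2 hy.1
    have := Ideal.mul_mem_left _ (X 1) (ih' hy.2 (by omega))
    convert this using 1
    simp only [fermatProduct, Nat.add_sub_cancel]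
    ring
  by_cases hz : 0 < k ∧ IsAdmissible n m i j (k - 1) p q r
  · obtain ⟨k, rfl⟩ := Nat.exists_eq_add_one.2 hz.1
    have := Ideal.mul_mem_left _ (X 2) (ih' hz.2 (by omega))
    convert this using 1
    simp only [fermatProduct, Nat.add_sub_cancel]
    ring
  have hx' : i = 0 ∨ i + k + n * q = m ∨ i + j + n * r = m := by
    unfold IsAdmissible at h hx
    omega
  have hy' : j = 0 ∨ j + k + n * p = m ∨ i + j + n * r = m := by
    unfold IsAdmissible at h hy
    omega
  have hz' : k = 0 ∨ j + k + n * p = m ∨ i + k + n * q = m := by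
    unfold IsAdmissible at h hz
    omega
  clear hx hy hz
  unfold IsAdmissible at h ih'
  by_cases hpqr : p + q + r = m
  · have hsum : n * p + n * q + n * r = n * m := by rw [← hpqr]; ring
    -- This is `(n - 2)(m - 1) ≥ 0`.
    have hprod : 2 * m + n ≤ n * m + 2 := by nlinarith
    by_cases hijk : i + j + k ≤ m
    · exact Ideal.subset_span ⟨i, j, k, p, q, r, h, hpqr, hijk, rfl⟩
    rcases exists_large_exponent h.2.1 h.2.2.1 hsum hprod hnm (not_le.1 hijk) hx' hy' hz'
      with ⟨hj, hk, hp, hlt⟩ | ⟨hi, hk, hq, hlt⟩ | ⟨hi, hj, hr, hlt⟩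
    -- Replacing `f` by `-(g + h)` gives `yz·f = -(z·(y g) + y·(z h))`. Each of `y g`, `z h` has one
    -- coordinate factor fewer. The condition at `(1:0:0)` loses `n + 1`, exactly the surplus
    -- available; a lost coordinate elsewhere is offset by the `n` gained from `g` or `h`.
    · have hp := Nat.pos_of_ne_zero (right_ne_zero_of_mul hp.ne')
      obtain ⟨j, rfl⟩ := Nat.exists_eq_add_one.2 hj
      obtain ⟨k, rfl⟩ := Nat.exists_eq_add_one.2 hk
      obtain ⟨p, rfl⟩ := Nat.exists_eq_add_one.2 hp
      simp only [mul_add, mul_one] at h hlt ih'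
      have h1 := @ih' i (j + 1) k p (q + 1) r (by simp only [mul_add, mul_one]; omega) (by
        simp only [mul_add, mul_one]; omega)
      have h2 := @ih' i j (k + 1) p q (r + 1) (by simp only [mul_add, mul_one]; omega) (by
        simp only [mul_add, mul_one]; omega)
      have := neg_mem (add_mem (Ideal.mul_mem_left _ (X 2) h1) (Ideal.mul_mem_left _ (X 1) h2))
      convert this using 1
      simp only [fermatProduct]
      ring
    · have hq := Nat.pos_of_ne_zero (right_ne_zero_of_mul hq.ne')
      obtain ⟨i, rfl⟩ := Nat.exists_eq_add_one.2 hi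
      obtain ⟨k, rfl⟩ := Nat.exists_eq_add_one.2 hk
      obtain ⟨q, rfl⟩ := Nat.exists_eq_add_one.2 hq
      simp only [mul_add, mul_one] at h hlt ih'
      have h1 := @ih' (i + 1) j k (p + 1) q r (by simp only [mul_add, mul_one]; omega) (by
        simp only [mul_add, mul_one]; omega)
      have h2 := @ih' i j (k + 1) p q (r + 1) (by simp only [mul_add, mul_one]; omega) (by
        simp only [mul_add, mul_one]; omega)
      have := neg_mem (add_mem (Ideal.mul_mem_left _ (X 2) h1) (Ideal.mul_mem_left _ (X 0) h2))
      convert this using 1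
      simp only [fermatProduct]
      ring
    · have hr := Nat.pos_of_ne_zero (right_ne_zero_of_mul hr.ne')
      obtain ⟨i, rfl⟩ := Nat.exists_eq_add_one.2 hi
      obtain ⟨j, rfl⟩ := Nat.exists_eq_add_one.2 hj
      obtain ⟨r, rfl⟩ := Nat.exists_eq_add_one.2 hr
      simp only [mul_add, mul_one] at h hlt ih'
      have h1 := @ih' (i + 1) j k (p + 1) q r (by simp only [mul_add, mul_one]; omega) (by
        simp only [mul_add, mul_one]; omega)
      have h2 := @ih' i (j + 1) k p (q + 1) r (by simp only [mul_add, mul_one]; omega) (by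
        simp only [mul_add, mul_one]; omega)
      have := neg_mem (add_mem (Ideal.mul_mem_left _ (X 1) h1) (Ideal.mul_mem_left _ (X 0) h2))
      convert this using 1
      simp only [fermatProduct]
      ring
  · clear hx' hy' hz'
    by_cases hp : 0 < p ∧ m < j + k + n * p
    · obtain ⟨hp, hlt⟩ := hp
      obtain ⟨p, rfl⟩ := Nat.exists_eq_add_one.2 hp
      simp only [mul_add, mul_one] at h hlt ih'
      exact fermatProduct_mem_of_first (by omega) (ih' (by omega) (by omega))
        (ih' (by omega) (by omega))
    by_cases hq : 0 < q ∧ m < i + k + n * q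
    · obtain ⟨hq, hlt⟩ := hq
      obtain ⟨q, rfl⟩ := Nat.exists_eq_add_one.2 hq
      simp only [mul_add, mul_one] at h hlt ih'
      exact fermatProduct_mem_of_second (by omega) (ih' (by omega) (by omega))
        (ih' (by omega) (by omega))
    by_cases hr : 0 < r ∧ m < i + j + n * r
    · obtain ⟨hr, hlt⟩ := hr
      obtain ⟨r, rfl⟩ := Nat.exists_eq_add_one.2 hr
      simp only [mul_add, mul_one] at h hlt ih'
      exact fermatProduct_mem_of_third (by omega) (ih' (by omega) (by omega))
        (ih' (by omega) (by omega))
    -- With no surplus left, `np`, `nq` and `nr` are each at most `m`, so `n(p+q+r) ≤ 3m ≤ nm`,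
    -- contradicting `p + q + r > m`.
    exfalso
    clear ih'
    have hsum : n * (m + 1) ≤ n * (p + q + r) := Nat.mul_le_mul_left n (by omega)
    simp only [mul_add, mul_one] at hsum
    have hp' : n * p ≤ m := by
      rcases Nat.eq_zero_or_pos p with rfl | h0
      · simp
      · omega
    have hq' : n * q ≤ m := by
      rcases Nat.eq_zero_or_pos q with rfl | h0
      · simp
      · omega
    have hr' : n * r ≤ m := by
      rcases Nat.eq_zero_or_pos r with rfl | h0
      · simp
      · omega
    omega

theorem span_fermatGenerators {n m : ℕ} (hn : 3 ≤ n) (hm : 1 ≤ m) :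
    Ideal.span (fermatGenerators K n m) = fermatFatIdeal K n m := by
  have : NeZero n := ⟨by omega⟩
  apply le_antisymm
  · rw [Ideal.span_le]
    rintro _ ⟨i, j, k, p, q, r, h, _, _, rfl⟩
    exact fermatProduct_mem_fermatFatIdeal h
  · intro u hu
    refine Ideal.span_le.2 ?_ (mem_span_fermatProduct hu)
    rintro _ ⟨i, j, k, p, q, r, h, rfl⟩
    exact fermatProduct_mem_span_fermatGenerators hn hm h

end FermatProducts
-- The symbolic powers as intersections, and the sharp degree.
section SymbolicPowersOfFermatIdeals

variable {K : Type*} [Field K] {n : ℕ}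

theorem X_pow_sub_X_pow_ne_zero {i j : Fin 3} (hij : i ≠ j) (hn : 0 < n) :
    (X i ^ n - X j ^ n : MvPolynomial (Fin 3) K) ≠ 0 := by
  intro h
  have := congrArg (aeval fun l => if l = i then (1 : K) else 0) h
  simp [hij.symm, hn.ne'] at this

theorem dvd_iff_residueCoord [NeZero n] {s u : MvPolynomial (Fin 3) K} :
    expand n s ∣ u ↔ ∀ ε : Fin 3 → Fin n, s ∣ residueCoord K n ε u := by
  have hmap : (Ideal.span {s}).map (expand n (σ := Fin 3) (R := K)) = Ideal.span {expand n s} := by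
    rw [Ideal.map_span, Set.image_singleton]
  simp only [← Ideal.mem_span_singleton]
  rw [← hmap]
  exact ⟨residueCoord_mem_of_mem_map, mem_map_expand_of_residueCoord_mem⟩

theorem X_pow_sub_X_pow_dvd_of_dvd_mul [NeZero n] (a : MvPolynomial (Fin 3) K)
    (h : X 1 ^ n - X 2 ^ n ∣ (X 2 ^ n - X 0 ^ n) * a) : X 1 ^ n - X 2 ^ n ∣ a := by
  have h1 : expand n (X 1 - X 2 : MvPolynomial (Fin 3) K) = X 1 ^ n - X 2 ^ n := by simp
  have h2 : expand n (X 2 - X 0 : MvPolynomial (Fin 3) K) = X 2 ^ n - X 0 ^ n := by simp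
  rw [← h1, dvd_iff_residueCoord] at h ⊢
  intro ε
  have h3 := h ε
  rw [← h2, residueCoord_expand_mul] at h3
  refine dvd_of_dvd_mul_of_aeval ![X 0, X 2, X 2] (fun i => ?_) ?_ ?_ h3
  · fin_cases i <;> simp
  · simp
  · simpa using X_sub_X_ne_zero (by decide)

theorem mem_of_X_mul_mem [NeZero n] (i : Fin 3) {t : MvPolynomial (Fin 3) K}
    (h : X i * t ∈ Ideal.span {(X 1 ^ n - X 2 ^ n : MvPolynomial (Fin 3) K), X 2 ^ n - X 0 ^ n}) :
    t ∈ Ideal.span {(X 1 ^ n - X 2 ^ n : MvPolynomial (Fin 3) K), X 2 ^ n - X 0 ^ n} := by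
  -- Completing `X i` to `X i ^ n` puts the multiplier in the subring, which reduces the claim
  -- coordinatewise to the prime ideal of `(1:1:1)`.
  have h1 : expand n (X i) * t ∈
      Ideal.span {(X 1 ^ n - X 2 ^ n : MvPolynomial (Fin 3) K), X 2 ^ n - X 0 ^ n} := by
    rw [expand_X, ← pow_sub_one_mul (NeZero.ne n) (X i), mul_assoc]
    exact Ideal.mul_mem_left _ _ h
  rw [← map_expand_span_pair] at h1 ⊢
  refine mem_map_expand_of_residueCoord_mem fun ε => ?_
  have h2 := residueCoord_mem_of_mem_map h1 ε
  rw [residueCoord_expand_mul] at h2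
  refine mem_span_pair_of_mul_mem ![X 0, X 0, X 0] (fun l => ?_) ?_ ?_ ?_ h2
  · fin_cases l
    · simp
    · exact Ideal.mem_span_pair.2 ⟨1, 1, by simp⟩
    · exact Ideal.mem_span_pair.2 ⟨0, 1, by simp⟩
  · simp
  · simp
  · fin_cases i <;> simp

theorem mem_of_X_pow_mul_mem [NeZero n] (i : Fin 3) (m : ℕ) {t : MvPolynomial (Fin 3) K}
    (h : X i ^ m * t ∈
      Ideal.span {(X 1 ^ n - X 2 ^ n : MvPolynomial (Fin 3) K), X 2 ^ n - X 0 ^ n}) :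
    t ∈ Ideal.span {(X 1 ^ n - X 2 ^ n : MvPolynomial (Fin 3) K), X 2 ^ n - X 0 ^ n} := by
  induction m with
  | zero => simpa using h
  | succ m ih => exact ih (mem_of_X_mul_mem i (by rwa [pow_succ', mul_assoc] at h))

theorem first_mem_fermatIdeal :
    (X 0 * (X 1 ^ n - X 2 ^ n) : MvPolynomial (Fin 3) K) ∈ fermatIdeal K n :=
  Ideal.subset_span (by simp)

theorem second_mem_fermatIdeal :
    (X 1 * (X 2 ^ n - X 0 ^ n) : MvPolynomial (Fin 3) K) ∈ fermatIdeal K n :=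
  Ideal.subset_span (by simp)

theorem third_mem_fermatIdeal :
    (X 2 * (X 0 ^ n - X 1 ^ n) : MvPolynomial (Fin 3) K) ∈ fermatIdeal K n :=
  Ideal.subset_span (by simp)

theorem fermatIdeal_le_iff {I : Ideal (MvPolynomial (Fin 3) K)} :
    fermatIdeal K n ≤ I ↔ X 0 * (X 1 ^ n - X 2 ^ n) ∈ I ∧ X 1 * (X 2 ^ n - X 0 ^ n) ∈ I ∧
      X 2 * (X 0 ^ n - X 1 ^ n) ∈ I := by
  simp [fermatIdeal, Ideal.span_le, Set.insert_subset_iff]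

theorem X_pow_sub_X_pow_mem_span (hn : 0 < n) (i j : Fin 3) :
    (X i ^ n - X j ^ n : MvPolynomial (Fin 3) K) ∈ Ideal.span {X i, X j} :=
  Ideal.pow_le_self hn.ne' (X_pow_sub_X_pow_mem i j (Ideal.subset_span (by simp))
    (Ideal.subset_span (by simp)))

theorem X_mul_mem_span_left (i j : Fin 3) (a : MvPolynomial (Fin 3) K) :
    X i * a ∈ Ideal.span {X i, X j} :=
  Ideal.mul_mem_right _ _ (Ideal.subset_span (by simp))

theorem X_mul_mem_span_right (i j : Fin 3) (a : MvPolynomial (Fin 3) K) :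
    X j * a ∈ Ideal.span {X i, X j} :=
  Ideal.mul_mem_right _ _ (Ideal.subset_span (by simp))

theorem fermatIdeal_le_unit :
    fermatIdeal K n ≤ Ideal.span {X 1 ^ n - X 2 ^ n, X 2 ^ n - X 0 ^ n} :=
  fermatIdeal_le_iff.2 ⟨Ideal.mem_span_pair.2 ⟨X 0, 0, by ring⟩,
    Ideal.mem_span_pair.2 ⟨0, X 1, by ring⟩, Ideal.mem_span_pair.2 ⟨-X 2, -X 2, by ring⟩⟩

theorem fermatIdeal_le_first (hn : 0 < n) : fermatIdeal K n ≤ Ideal.span {X 1, X 2} :=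
  fermatIdeal_le_iff.2 ⟨Ideal.mul_mem_left _ _ (X_pow_sub_X_pow_mem_span hn 1 2),
    X_mul_mem_span_left _ _ _, X_mul_mem_span_right _ _ _⟩

theorem fermatIdeal_le_second (hn : 0 < n) : fermatIdeal K n ≤ Ideal.span {X 0, X 2} :=
  fermatIdeal_le_iff.2 ⟨X_mul_mem_span_left _ _ _, Ideal.mul_mem_left _ _ (by
    rw [Set.pair_comm]; exact X_pow_sub_X_pow_mem_span hn 2 0), X_mul_mem_span_right _ _ _⟩

theorem fermatIdeal_le_third (hn : 0 < n) : fermatIdeal K n ≤ Ideal.span {X 0, X 1} :=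
  fermatIdeal_le_iff.2 ⟨X_mul_mem_span_left _ _ _, X_mul_mem_span_right _ _ _,
    Ideal.mul_mem_left _ _ (X_pow_sub_X_pow_mem_span hn 0 1)⟩

theorem mem_span_X_pair_of_mul_mem {i j k : Fin 3} (hij : i ≠ j) (hik : i ≠ k) (hjk : j ≠ k)
    {s t : MvPolynomial (Fin 3) K}
    (hs : aeval (fun l => if l = k then (X k : MvPolynomial (Fin 3) K) else 0) s ≠ 0)
    (hst : s * t ∈ Ideal.span {(X i : MvPolynomial (Fin 3) K), X j}) :
    t ∈ Ideal.span {(X i : MvPolynomial (Fin 3) K), X j} := by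
  have := mem_span_X_pair_pow_of_mul_mem hij hik hjk hs 1 (t := t)
  rw [pow_one] at this
  exact this hst

/-- The Fermat ideal is the intersection of the ideals of its points. -/
theorem mem_fermatIdeal (hn : 0 < n) {t : MvPolynomial (Fin 3) K}
    (h1 : t ∈ Ideal.span {(X 1 ^ n - X 2 ^ n : MvPolynomial (Fin 3) K), X 2 ^ n - X 0 ^ n})
    (h2 : t ∈ Ideal.span {(X 1 : MvPolynomial (Fin 3) K), X 2})
    (h3 : t ∈ Ideal.span {(X 0 : MvPolynomial (Fin 3) K), X 2})
    (h4 : t ∈ Ideal.span {(X 0 : MvPolynomial (Fin 3) K), X 1}) : t ∈ fermatIdeal K n := by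
  obtain ⟨a, b, rfl⟩ := Ideal.mem_span_pair.1 h1
  have hf := X_pow_sub_X_pow_mem_span (K := K) hn 1 2
  have hg := X_pow_sub_X_pow_mem_span (K := K) hn 2 0
  have hh := X_pow_sub_X_pow_mem_span (K := K) hn 0 1
  rw [Set.pair_comm] at hg
  -- For `t = a f + b g`, each coordinate point constrains the coefficient whose form does not
  -- vanish there; at `(0:0:1)`, `t + a h = (b - a) g` is used.
  have ha : a ∈ Ideal.span {(X 0 : MvPolynomial (Fin 3) K), X 2} := by
    refine mem_span_X_pair_of_mul_mem (k := 1) (by decide) (by decide) (by decide)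
      (s := X 1 ^ n - X 2 ^ n) ?_ ?_
    · simp [hn.ne']
    · have := sub_mem h3 (Ideal.mul_mem_left _ b hg)
      convert this using 1
      ring
  have hb : b ∈ Ideal.span {(X 1 : MvPolynomial (Fin 3) K), X 2} := by
    refine mem_span_X_pair_of_mul_mem (k := 0) (by decide) (by decide) (by decide)
      (s := X 2 ^ n - X 0 ^ n) ?_ ?_
    · simp [hn.ne']
    · have := sub_mem h2 (Ideal.mul_mem_left _ a hf)
      convert this using 1
      ring
  have hba : b - a ∈ Ideal.span {(X 0 : MvPolynomial (Fin 3) K), X 1} := by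
    refine mem_span_X_pair_of_mul_mem (k := 2) (by decide) (by decide) (by decide)
      (s := X 2 ^ n - X 0 ^ n) ?_ ?_
    · simp [hn.ne']
    · have := add_mem h4 (Ideal.mul_mem_left _ a hh)
      convert this using 1
      ring
  obtain ⟨a₁, a₂, rfl⟩ := Ideal.mem_span_pair.1 ha
  obtain ⟨b₁, b₂, rfl⟩ := Ideal.mem_span_pair.1 hb
  have hc : b₂ - a₂ ∈ Ideal.span {(X 0 : MvPolynomial (Fin 3) K), X 1} := by
    refine mem_span_X_pair_of_mul_mem (k := 2) (by decide) (by decide) (by decide) (s := X 2) ?_ ?_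
    · simp
    · have := add_mem hba (Ideal.mem_span_pair.2 ⟨a₁, -b₁, rfl⟩)
      convert this using 1
      ring
  obtain ⟨c, d, hcd⟩ := Ideal.mem_span_pair.1 hc
  have := add_mem (add_mem (Ideal.mul_mem_left _ (a₁ - X 2 * c)
    (first_mem_fermatIdeal (K := K) (n := n)))
    (Ideal.mul_mem_left _ (b₁ + X 2 * d) (second_mem_fermatIdeal (K := K) (n := n))))
    (Ideal.mul_mem_left _ (-a₂ - X 0 * c) (third_mem_fermatIdeal (K := K) (n := n)))
  convert this using 1
  linear_combination (-(X 2 : MvPolynomial (Fin 3) K) * (X 2 ^ n - X 0 ^ n)) * hcd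

theorem pow_mul_mem_pow {R : Type*} [CommRing R] {I P : Ideal R} {w h : R} {m : ℕ}
    (hw : ∀ a ∈ P, w * a ∈ I) (hh : h ∈ P ^ m) : w ^ m * h ∈ I ^ m := by
  have hle : Ideal.span {w} * P ≤ I := by
    rw [Ideal.span_singleton_mul_le_iff]
    exact hw
  have h2 := Ideal.pow_right_mono hle m
  rw [mul_pow, Ideal.span_singleton_pow] at h2
  exact h2 (Ideal.mul_mem_mul (Ideal.mem_span_singleton_self _) hh)

/-- The multiplier vanishes on all other components of the configuration; likewise in the three
lemmas that follow. -/
theorem mul_mem_fermatIdeal_of_unit {a : MvPolynomial (Fin 3) K}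
    (ha : a ∈ Ideal.span {(X 1 ^ n - X 2 ^ n : MvPolynomial (Fin 3) K), X 2 ^ n - X 0 ^ n}) :
    X 0 * X 1 * X 2 * a ∈ fermatIdeal K n := by
  obtain ⟨b, c, rfl⟩ := Ideal.mem_span_pair.1 ha
  have := add_mem (Ideal.mul_mem_left _ (X 1 * X 2 * b) (first_mem_fermatIdeal (K := K) (n := n)))
    (Ideal.mul_mem_left _ (X 0 * X 2 * c) (second_mem_fermatIdeal (K := K) (n := n)))
  convert this using 1
  ring

theorem mul_mem_fermatIdeal_of_first {a : MvPolynomial (Fin 3) K}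
    (ha : a ∈ Ideal.span {(X 1 : MvPolynomial (Fin 3) K), X 2}) :
    (X 2 ^ n - X 0 ^ n) * (X 0 ^ n - X 1 ^ n) * a ∈ fermatIdeal K n := by
  obtain ⟨b, c, rfl⟩ := Ideal.mem_span_pair.1 ha
  have := add_mem
    (Ideal.mul_mem_left _ ((X 0 ^ n - X 1 ^ n) * b) (second_mem_fermatIdeal (K := K) (n := n)))
    (Ideal.mul_mem_left _ ((X 2 ^ n - X 0 ^ n) * c) (third_mem_fermatIdeal (K := K) (n := n)))
  convert this using 1
  ring

theorem mul_mem_fermatIdeal_of_second {a : MvPolynomial (Fin 3) K}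
    (ha : a ∈ Ideal.span {(X 0 : MvPolynomial (Fin 3) K), X 2}) :
    (X 1 ^ n - X 2 ^ n) * (X 0 ^ n - X 1 ^ n) * a ∈ fermatIdeal K n := by
  obtain ⟨b, c, rfl⟩ := Ideal.mem_span_pair.1 ha
  have := add_mem
    (Ideal.mul_mem_left _ ((X 0 ^ n - X 1 ^ n) * b) (first_mem_fermatIdeal (K := K) (n := n)))
    (Ideal.mul_mem_left _ ((X 1 ^ n - X 2 ^ n) * c) (third_mem_fermatIdeal (K := K) (n := n)))
  convert this using 1
  ring

theorem mul_mem_fermatIdeal_of_third {a : MvPolynomial (Fin 3) K}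
    (ha : a ∈ Ideal.span {(X 0 : MvPolynomial (Fin 3) K), X 1}) :
    (X 1 ^ n - X 2 ^ n) * (X 2 ^ n - X 0 ^ n) * a ∈ fermatIdeal K n := by
  obtain ⟨b, c, rfl⟩ := Ideal.mem_span_pair.1 ha
  have := add_mem
    (Ideal.mul_mem_left _ ((X 2 ^ n - X 0 ^ n) * b) (first_mem_fermatIdeal (K := K) (n := n)))
    (Ideal.mul_mem_left _ ((X 1 ^ n - X 2 ^ n) * c) (second_mem_fermatIdeal (K := K) (n := n)))
  convert this using 1
  ring

/-- If `s` vanished at the point, `s * w` would lie in `I`, hence so would `w`, although `w` does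
not vanish there. -/
theorem aeval_ne_zero_of_nonzerodivisor {I : Ideal (MvPolynomial (Fin 3) K)} {i j k : Fin 3}
    (hik : i ≠ k) (hjk : j ≠ k) (hijk : ∀ l, l ≠ k → l = i ∨ l = j)
    {w s : MvPolynomial (Fin 3) K}
    (hI : I ≤ Ideal.span {X i, X j})
    (hw : ∀ a ∈ Ideal.span {(X i : MvPolynomial (Fin 3) K), X j}, w * a ∈ I)
    (hw0 : aeval (fun l => if l = k then (X k : MvPolynomial (Fin 3) K) else 0) w ≠ 0)
    (hs : ∀ t, s * t ∈ I → t ∈ I) :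
    aeval (fun l => if l = k then (X k : MvPolynomial (Fin 3) K) else 0) s ≠ 0 := by
  intro h0
  have hsmem : s ∈ Ideal.span {(X i : MvPolynomial (Fin 3) K), X j} := by
    have := sub_aeval_mem (Ideal.span {(X i : MvPolynomial (Fin 3) K), X j})
      (fun l => if l = k then (X k : MvPolynomial (Fin 3) K) else 0) (fun l => ?_) s
    · rwa [h0, sub_zero] at this
    · by_cases hl : l = k
      · subst hl
        simp
      · rw [if_neg hl, sub_zero]
        refine Ideal.subset_span ?_
        rcases hijk l hl with rfl | rfl <;> simp
  have hwI : w ∈ Ideal.span {(X i : MvPolynomial (Fin 3) K), X j} :=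
    hI (hs w (by rw [mul_comm]; exact hw s hsmem))
  obtain ⟨b, c, rfl⟩ := Ideal.mem_span_pair.1 hwI
  exact hw0 (by simp [hik, hjk])

theorem symbolicPower_fermatIdeal [NeZero n] {m : ℕ} (hm : 1 ≤ m) :
    symbolicPower (fermatIdeal K n) m = fermatFatIdeal K n m := by
  have hn : 0 < n := Nat.pos_of_ne_zero (NeZero.ne n)
  have hn0 : n ≠ 0 := hn.ne'
  have hm0 : m ≠ 0 := by omega
  apply le_antisymm
  · intro h hh
    obtain ⟨s, hs, hsh⟩ := exists_nonzerodivisor_of_mem_symbolicPower hh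
    refine Ideal.mem_inf.2 ⟨?_, Ideal.mem_inf.2 ⟨?_, Ideal.mem_inf.2 ⟨?_, ?_⟩⟩⟩
    · refine mem_pow_of_nonzerodivisor_mul_mem (X_pow_sub_X_pow_ne_zero (by decide) hn)
        X_pow_sub_X_pow_dvd_of_dvd_mul (fun t ht => ?_) m
        (Ideal.pow_right_mono fermatIdeal_le_unit m hsh)
      have h1 := hs (X 0 * X 1 * X 2 * t) (by
        have := mul_mem_fermatIdeal_of_unit ht
        convert this using 1
        ring)
      have h2 := fermatIdeal_le_unit h1
      rw [mul_assoc, mul_assoc] at h2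
      exact mem_of_X_mul_mem 2 (mem_of_X_mul_mem 1 (mem_of_X_mul_mem 0 h2))
    · refine mem_span_X_pair_pow_of_mul_mem (k := 0) (by decide) (by decide) (by decide) ?_ m
        (Ideal.pow_right_mono (fermatIdeal_le_first hn) m hsh)
      refine aeval_ne_zero_of_nonzerodivisor (by decide) (by decide) (by decide)
        (fermatIdeal_le_first hn) (fun a => mul_mem_fermatIdeal_of_first) ?_ hs
      simp [hn0]
    · refine mem_span_X_pair_pow_of_mul_mem (k := 1) (by decide) (by decide) (by decide) ?_ m
        (Ideal.pow_right_mono (fermatIdeal_le_second hn) m hsh)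
      refine aeval_ne_zero_of_nonzerodivisor (by decide) (by decide) (by decide)
        (fermatIdeal_le_second hn) (fun a => mul_mem_fermatIdeal_of_second) ?_ hs
      simp [hn0]
    · refine mem_span_X_pair_pow_of_mul_mem (k := 2) (by decide) (by decide) (by decide) ?_ m
        (Ideal.pow_right_mono (fermatIdeal_le_third hn) m hsh)
      refine aeval_ne_zero_of_nonzerodivisor (by decide) (by decide) (by decide)
        (fermatIdeal_le_third hn) (fun a => mul_mem_fermatIdeal_of_third) ?_ hs
      simp [hn0]
  · rintro h ⟨h1, h2, h3, h4⟩
    -- The denominator is the sum of the `m`-th powers of the four multipliers. On each component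
    -- only one summand survives, so the sum is a nonzerodivisor modulo the Fermat ideal.
    refine mem_symbolicPower_of_nonzerodivisor
      (s := (X 0 * X 1 * X 2) ^ m + ((X 2 ^ n - X 0 ^ n) * (X 0 ^ n - X 1 ^ n)) ^ m +
        ((X 1 ^ n - X 2 ^ n) * (X 0 ^ n - X 1 ^ n)) ^ m +
        ((X 1 ^ n - X 2 ^ n) * (X 2 ^ n - X 0 ^ n)) ^ m) (fun t ht => ?_) ?_
    · refine mem_fermatIdeal hn ?_ ?_ ?_ ?_
      · have hf : (X 1 ^ n - X 2 ^ n : MvPolynomial (Fin 3) K) ∈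
            Ideal.span {(X 1 ^ n - X 2 ^ n : MvPolynomial (Fin 3) K), X 2 ^ n - X 0 ^ n} :=
          Ideal.subset_span (by simp)
        have hg : (X 2 ^ n - X 0 ^ n : MvPolynomial (Fin 3) K) ∈
            Ideal.span {(X 1 ^ n - X 2 ^ n : MvPolynomial (Fin 3) K), X 2 ^ n - X 0 ^ n} :=
          Ideal.subset_span (by simp)
        have e1 := Ideal.pow_mem_of_mem _ (Ideal.mul_mem_right (X 0 ^ n - X 1 ^ n) _ hg) m (by omega)
        have e2 := Ideal.pow_mem_of_mem _ (Ideal.mul_mem_right (X 0 ^ n - X 1 ^ n) _ hf) m (by omega)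
        have e3 := Ideal.pow_mem_of_mem _ (Ideal.mul_mem_right (X 2 ^ n - X 0 ^ n) _ hf) m (by omega)
        have e4 := sub_mem (fermatIdeal_le_unit ht)
          (Ideal.mul_mem_right t _ (add_mem (add_mem e1 e2) e3))
        have e5 : X 0 ^ m * (X 1 ^ m * (X 2 ^ m * t)) ∈
            Ideal.span {(X 1 ^ n - X 2 ^ n : MvPolynomial (Fin 3) K), X 2 ^ n - X 0 ^ n} := by
          convert e4 using 1
          ring
        exact mem_of_X_pow_mul_mem 2 m (mem_of_X_pow_mul_mem 1 m (mem_of_X_pow_mul_mem 0 m e5))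
      · refine mem_span_X_pair_of_mul_mem (k := 0) (by decide) (by decide) (by decide) ?_
          (fermatIdeal_le_first hn ht)
        simp [hn0, hm0]
      · refine mem_span_X_pair_of_mul_mem (k := 1) (by decide) (by decide) (by decide) ?_
          (fermatIdeal_le_second hn ht)
        simp [hn0, hm0]
      · refine mem_span_X_pair_of_mul_mem (k := 2) (by decide) (by decide) (by decide) ?_
          (fermatIdeal_le_third hn ht)
        simp [hn0, hm0]
    · rw [add_mul, add_mul, add_mul]
      exact add_mem (add_mem (add_mem (pow_mul_mem_pow (fun a => mul_mem_fermatIdeal_of_unit) h1)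
        (pow_mul_mem_pow (fun a => mul_mem_fermatIdeal_of_first) h2))
        (pow_mul_mem_pow (fun a => mul_mem_fermatIdeal_of_second) h3))
        (pow_mul_mem_pow (fun a => mul_mem_fermatIdeal_of_third) h4)

theorem X_two_not_dvd_X_pow_sub_X_pow (hn : 0 < n) :
    ¬ (X 2 : MvPolynomial (Fin 3) K) ∣ X 2 ^ n - X 0 ^ n := by
  rw [dvd_sub_right (dvd_pow_self _ hn.ne')]
  intro h
  have := X_dvd_X.1 (X_prime.dvd_of_dvd_pow h)
  exact absurd this (by decide)

/-- Forms of small degree vanishing to order `m` on the Fermat configuration vanish on the line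
`y = z`. -/
theorem aeval_eq_zero_of_lt_degree {m d : ℕ} (hn : 0 < n) {u : MvPolynomial (Fin 3) K}
    (hu : u ∈ fermatFatIdeal K n m) (hd : u.IsHomogeneous d) (hlt : d < m * (n + 1)) :
    aeval ![X 0, X 2, X 2] u = (0 : MvPolynomial (Fin 3) K) := by
  obtain ⟨h1, h2, -⟩ := hu
  rw [SetLike.mem_coe, span_X_one_X_two_eq] at h2
  -- Since `y - z ∣ yⁿ - zⁿ`, enlarging the ideal makes restriction to `y = z` give divisibility by
  -- `(zⁿ - xⁿ)^m`.
  have h1' : u ∈ Ideal.span {(X 1 - X 2 : MvPolynomial (Fin 3) K), X 2 ^ n - X 0 ^ n} ^ m := by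
    refine Ideal.pow_right_mono ?_ m h1
    rw [Ideal.span_le, Set.insert_subset_iff, Set.singleton_subset_iff]
    refine ⟨?_, Ideal.subset_span (by simp)⟩
    exact Ideal.mem_of_dvd _ (sub_dvd_pow_sub_pow _ _ n) (Ideal.subset_span (by simp))
  obtain ⟨w, hw⟩ := exists_aeval_eq_pow_mul_pow_mul ![X 0, X 2, X 2] (by simp) (by simp) (by simp)
    (X_prime (i := (2 : Fin 3))) (X_two_not_dvd_X_pow_sub_X_pow hn) h2 h1'
  have hhom : (X 2 ^ m * (X 2 ^ n - X 0 ^ n) ^ m * w : MvPolynomial (Fin 3) K).IsHomogeneous d := by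
    rw [← hw, ← one_mul d]
    refine hd.aeval _ fun i => ?_
    fin_cases i <;> simpa using isHomogeneous_X K _
  have hw0 : w = 0 := by
    refine eq_zero_of_forall_mem_support fun e he => ?_
    have := degree_add_eq_of_isHomogeneous_mul
      (mul_ne_zero (pow_ne_zero _ (X_ne_zero _))
        (pow_ne_zero _ (X_pow_sub_X_pow_ne_zero (by decide) hn)))
      ((isHomogeneous_X_pow (R := K) (2 : Fin 3) m).mul
        ((isHomogeneous_X_pow_sub_X_pow 2 0 n).pow m)) hhom he
    nlinarith
  rw [hw, hw0, mul_zero]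

theorem isMaxGeneratorDegree_symbolicPower (K : Type*) [Field K] {n m : ℕ} (hn : 3 ≤ n)
    (hm : 1 ≤ m) :
    IsMaxGeneratorDegree (symbolicPower (fermatIdeal K n) m) (m * (n + 1)) := by
  have : NeZero n := ⟨by omega⟩
  rw [symbolicPower_fermatIdeal hm]
  refine isMaxGeneratorDegree_of_generators (finite_fermatGenerators n m)
    (fun u => exists_isHomogeneous_of_mem_fermatGenerators) (span_fermatGenerators hn hm)
    ⟨RingHom.ker (aeval ![X 0, X 2, X 2] : MvPolynomial (Fin 3) K →ₐ[K] MvPolynomial (Fin 3) K),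
      fun hle => ?_, fun u hu d hd hhom => aeval_eq_zero_of_lt_degree (by omega) hu hhom hd⟩
  -- The witness `z^m (xⁿ - yⁿ)^m` has degree `m(n+1)` and restricts to `z^m (xⁿ - zⁿ)^m ≠ 0`.
  have hmem : fermatProduct K n 0 0 m 0 0 m ∈ fermatFatIdeal K n m := by
    refine fermatProduct_mem_fermatFatIdeal ⟨by omega, by omega, by omega, ?_⟩
    have := Nat.le_mul_of_pos_left m (show 0 < n by omega)
    omega
  have h0 := hle hmem
  rw [RingHom.mem_ker] at h0
  have hne : (X 0 ^ n - X 2 ^ n : MvPolynomial (Fin 3) K) ≠ 0 :=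
    X_pow_sub_X_pow_ne_zero (by decide) (by omega)
  simp [fermatProduct, hne] at h0

end SymbolicPowersOfFermatIdeals
end FermatConfiguration

theorem mainTheorem12 (K : Type*) [Field K] [IsAlgClosed K] [CharZero K] (n : ℕ) (hn : 3 ≤ n) :
    (∀ m : ℕ, 1 ≤ m →
      ∃ d : ℕ, FermatConfiguration.IsMaxGeneratorDegree
          (FermatConfiguration.symbolicPower (FermatConfiguration.fermatIdeal K n) m) d ∧
        m * (n + 1) ≤ d) ∧
    (∀ m : ℕ, (n : ℤ) ^ 2 - 3 * (n : ℤ) + 2 ≤ (m : ℤ) →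
      FermatConfiguration.IsMaxGeneratorDegree
        (FermatConfiguration.symbolicPower (FermatConfiguration.fermatIdeal K n) m)
        (m * (n + 1))) := by
  refine ⟨fun m hm => ⟨_, FermatConfiguration.isMaxGeneratorDegree_symbolicPower K hn hm, le_rfl⟩,
    fun m hm => FermatConfiguration.isMaxGeneratorDegree_symbolicPower K hn ?_⟩
  have : (3 : ℤ) ≤ n := by exact_mod_cast hn
  -- The bound is `(n - 1)(n - 2) ≥ 2`.
  have : (1 : ℤ) ≤ m := by nlinarith
  exact_mod_cast this
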